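/- **Setting.** Let $\rho$ be a base measure on an observation space $\mathcal X$ and $F:\mathcal X\to\mathbb R^d$ a feature map. Put $\mathcal L(\theta)=\log\int e^{\langle\theta,F(x)\rangle}\,d\rho(x)$, $\Theta_{\mathcal D}=\{\mathcal L<\infty\}$, $p_\theta=e^{\langle\theta,F\rangle-\mathcal L(\theta)}\rho$ and $\mathcal B(\theta',\theta)=\mathcal L(\theta')-\mathcal L(\theta)-\langle\theta'-\theta,\nabla\mathcal L(\theta)\rangle$. Let $\Theta\subset\Theta_{\mathcal D}$ be the parameter set and $\nu$ a measure on $\Theta$ (Lebesgue measure, except where stated). For $c>0$, $\delta\in(0,1]$, $\theta_0\in\Theta$ and observations $X_1,\dots,X_n$ let $\theta_{n,c}(\theta_0)=(\nabla\mathcal L)^{-1}\big(\frac{1}{n+c}(\sum_{t\le n}F(X_t)+c\nabla\mathcal L(\theta_0))\big)\in\Theta_{\mathcal D}$, $$\gamma_{n,c}(\theta_0)=\log\frac{\int e^{-c\,\mathcal B(\theta',\theta_0)}\,d\nu(\theta')}{\int e^{-(n+c)\,\mathcal B(\theta',\theta_{n,c}(\theta_0))}\,d\nu(\theta')},$$ $$\Theta_{n,c}(\delta)=\Big\{\theta_0\in\Theta:(n+c)\,\mathcal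 B(\theta_0,\theta_{n,c}(\theta_0))\le\log\tfrac1\delta+\gamma_{n,c}(\theta_0)\Big\}.$$ **Claim.** For each family below and each value of its parameters, the distribution equals $p_\theta$ for the given $\rho,F,\theta\in\Theta$. For all $n\ge0$ and all observations in the given support (which carries the distribution), the estimate $\theta_{n,c}(\theta)$ exists and is unique in $\Theta_{\mathcal D}$, the two integrals in $\gamma_{n,c}(\theta)$ are finite and positive, $\gamma_{n,c}(\theta)$ has the stated value, and $\theta\in\Theta_{n,c}(\delta)$ if and only if the stated inequality $(*)$ holds. If $X_1,X_2,\dots$ are i.i.d. with this distribution, then with probability at least $1-\delta$ inequality $(*)$ holds for all $n\ge0$ simultaneously. **Notation.** $S_n=\sum_{t\le n}X_t$, $\hat\mu_n=S_n/n$, $Q_n(\mu)=\sum_{t\le n}(X_t-\mu)^2$, $Z_n(\mu,\sigma)=Q_n(\mu)/\sigma^2$, $S_n^{(k)}=\sum_{t\le n}X_t^k$, $L_n=\sum_{t\le n}\log X_t$, $K_n=\sum_{t\le n}\log\frac{X_t}2$; $\psi_0=(\log\Gamma)'$; $\mathbf B(a,b)=\Gamma(a)\Gamma(b)/\Gamma(a+b)$;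 $\mathbb H(p)=-p\log p-(1-p)\log(1-p)$; $I(a,b)=\int_{\mathbb R}e^{-ae^\theta+b\theta}\,d\theta$; $J(a,b)=\int\exp(-a\log\Gamma(\frac k2)+\frac{bk}2)\,dk$. For $n=0$ sums are empty and $\hat\mu_0=0$. 1. *Gaussian $\mathcal N(\mu,\sigma^2)$, $\sigma>0$ known, $\mu\in\mathbb R$ unknown.* Support $\mathbb R$; $\rho=\mathcal N(0,\sigma^2)$, $F(x)=x/\sigma^2$, $\theta=\mu$, $\Theta=\mathbb R$. $\gamma=\frac12\log\frac{n+c}c$. $(*)$ $\frac1{n+c}\frac{(S_n-n\mu)^2}{2\sigma^2}\le\log\frac1\delta+\frac12\log\frac{n+c}c$. 2. *Gaussian, $\mu\in\mathbb R$ known, $\sigma>0$ unknown.* Support $\mathbb R$; $\rho=(2\pi)^{-1/2}dx$, $F(x)=(x-\mu)^2$, $\theta=-\frac1{2\sigma^2}$, $\Theta=(-\infty,0)$. $\gamma=\log\frac{Q_n(\mu)/\sigma^2+c}{n+c}-(1+\log2)\frac n2-(\frac c2+1)\log c+(\frac{n+c}2+1)\log(n+c)+\log\frac{\Gamma(\frac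 c2+1)}{\Gamma(\frac{n+c}2+1)}$. $(*)$ $\frac{Q_n(\mu)}{2\sigma^2}-(\frac{n+c}2+1)\log\big(\frac{Q_n(\mu)}{\sigma^2}+c\big)\le\log\frac1\delta+\log\frac{\Gamma(\frac c2+1)}{\Gamma(\frac{n+c}2+1)}-\frac n2\log2-(\frac c2+1)\log c$. 3. *Gaussian, $\mu\in\mathbb R$ and $\sigma>0$ both unknown.* Support $\mathbb R$; $\rho=\pi^{-1/2}dx$, $F(x)=(x,x^2)$, $\theta=(\frac\mu{\sigma^2},-\frac1{2\sigma^2})$, $\Theta=\mathbb R\times(-\infty,0)$. With $W_n=\frac n{n+c}Z_n(\hat\mu_n,\sigma)+\frac c{n+c}Z_n(\mu,\sigma)+c$: $\gamma=\frac32\log W_n+\frac{n+c+1}2\log(n+c)-(\frac c2+2)\log c-\frac n2(1+\log2)+\log\Gamma(\frac{c+3}2)-\log\Gamma(\frac{n+c+3}2)$. $(*)$ $\frac12Z_n(\mu,\sigma)-\frac{n+c+3}2\log W_n\le\log\frac1\delta-\frac n2\log2-(\frac c2+2)\log c+\frac12\log(n+c)+\log\Gamma(\frac{c+3}2)-\log\Gamma(\frac{n+c+3}2)$.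 4. *Bernoulli($\mu$), $\mu\in(0,1)$.* Support $\{0,1\}$; $\rho$ counting measure on $\{0,1\}$, $F(x)=x$, $\theta=\log\frac\mu{1-\mu}$, $\Theta=\mathbb R$. With $\mu_n=\frac{S_n+c\mu}{n+c}$: $\gamma=c\,\mathbb H(\mu)-(n+c)\mathbb H(\mu_n)+\log\frac{\mathbf B(c\mu,\,c(1-\mu))}{\mathbf B(S_n+c\mu,\,n-S_n+c(1-\mu))}$. $(*)$ $S_n\log\frac1\mu+(n-S_n)\log\frac1{1-\mu}+\log\frac{\Gamma(S_n+c\mu)\Gamma(n-S_n+c(1-\mu))}{\Gamma(c\mu)\Gamma(c(1-\mu))}\le\log\frac1\delta+\log\frac{\Gamma(n+c)}{\Gamma(c)}$. 5. *Exponential with mean $\mu>0$.* Support $[0,\infty)$; $\rho=dx$ on $[0,\infty)$, $F(x)=x$, $\theta=-\frac1\mu$, $\Theta=(-\infty,0)$. $\gamma=\log(\frac{S_n}\mu+c)+\log\frac{\Gamma(c)}{\Gamma(n+c)}+(n+c-1)\log(n+c)-c\log c-n$. $(*)$ $\frac{S_n}\mu-(n+c+1)\log(\frac{S_n}\mu+c)\le\log\frac1\delta+\log\frac{\Gamma(c)}{\Gamma(n+c)}-\log(n+c)-c\log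 c$. 6. *Gamma, shape $k>0$ known, scale $\lambda>0$ unknown.* Support $[0,\infty)$; $\rho=\frac{x^{k-1}}{\Gamma(k)}dx$ on $[0,\infty)$, $F(x)=x$, $\theta=-\frac1\lambda$, $\Theta=(-\infty,0)$. $\gamma=\log\frac{S_n+ck\lambda}{(n+c)k\lambda}+\log\big(\Gamma(ck)(\frac e{ck})^{ck}\big)-\log\big(\Gamma((n+c)k)(\frac e{(n+c)k})^{(n+c)k}\big)$. $(*)$ $\frac{S_n}\lambda-((n+c)k+1)\log(\frac{S_n}\lambda+ck)\le\log\frac1\delta+\log\frac{\Gamma(ck)}{\Gamma((n+c)k)}-\log((n+c)k)-ck\log(ck)$. 7. *Weibull, shape $k>0$ known, scale $\lambda>0$ unknown* (density $\frac k\lambda(\frac x\lambda)^{k-1}e^{-(x/\lambda)^k}$). Support $[0,\infty)$; $\rho=kx^{k-1}dx$ on $[0,\infty)$, $F(x)=x^k$, $\theta=-\lambda^{-k}$, $\Theta=(-\infty,0)$. $\gamma=\log\frac{S_n^{(k)}+c\lambda^k}{(n+c)\lambda^k}+\log\big(\Gamma(c)(\frac ec)^c\big)-\log\big(\Gamma(n+c)(\frac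 e{n+c})^{n+c}\big)$. $(*)$ $\frac{S_n^{(k)}}{\lambda^k}-(n+c+1)\log\big(\frac{S_n^{(k)}}{\lambda^k}+c\big)\le\log\frac1\delta+\log\frac{\Gamma(c)}{\Gamma(n+c)}-\log(n+c)-c\log c$. 8. *Pareto with scale $1$ and shape $\alpha>0$ unknown* (density $\alpha x^{-\alpha-1}$ on $[1,\infty)$). Support $[1,\infty)$; $\rho=dx$ on $[1,\infty)$, $F(x)=\log x$, $\theta=-1-\alpha$, $\Theta=(-\infty,-1)$. $\gamma=\log(\alpha L_n+c)+\log\frac{\Gamma(c)}{\Gamma(n+c)}+(n+c-1)\log(n+c)-c\log c-n$. $(*)$ $\alpha L_n-(n+c+1)\log(\alpha L_n+c)\le\log\frac1\delta+\log\frac{\Gamma(c)}{\Gamma(n+c)}-\log(n+c)-c\log c$. 9. *Poisson($\lambda$), $\lambda>0$.* Support $\{0,1,2,\dots\}$; $\rho(\{j\})=\frac1{j!}$, $F(j)=j$, $\theta=\log\lambda$, $\Theta=\mathbb R$. $\gamma=c(1-\log\lambda)\lambda-\big(1-\log\frac{S_n+c\lambda}{n+c}\big)(S_n+c\lambda)+\log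 I(c,c\lambda)-\log I(n+c,S_n+c\lambda)$. $(*)$ $n\lambda-S_n\log\lambda\le\log\frac1\delta+\log I(c,c\lambda)-\log I(n+c,S_n+c\lambda)$. 10. *Chi-square with $k$ degrees of freedom (Gamma with shape $\frac k2$ and rate $\frac12$).* Support $(0,\infty)$; $\rho=e^{-x/2}dx$ on $(0,\infty)$, $F(x)=\log x$, $\theta=\frac k2-1$, in two versions: (a) $k>0$ real, $\Theta=(-1,\infty)$, $\nu$ Lebesgue measure and $dk$ in $J$ Lebesgue measure on $(0,\infty)$; (b) $k\in\{1,2,\dots\}$, $\Theta=\{\frac j2-1:j=1,2,\dots\}$, $\nu$ counting measure on $\Theta$ and $dk$ in $J$ counting measure on $\{1,2,\dots\}$. With $B_n=K_n+c\,\psi_0(\frac k2)$ and $k_n>0$ given by $\psi_0(\frac{k_n}2)=\frac{B_n}{n+c}$: $\gamma=\frac{k_n}2B_n-(n+c)\log\Gamma(\frac{k_n}2)+c\log\Gamma(\frac k2)-c\frac k2\psi_0(\frac k2)+\log\frac{J(c,\,c\psi_0(k/2))}{J(n+c,\,B_n)}$. $(*)$ $n\log\Gamma(\frac k2)-\frac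 k2K_n-\log J\big(c,c\psi_0(\tfrac k2)\big)+\log J(n+c,B_n)\le\log\frac1\delta$. -/

import Mathlib

open MeasureTheory ProbabilityTheory

noncomputable section

namespace BregmanCS

section Generic

variable {𝒳 E Ω : Type*} [MeasurableSpace 𝒳] [MeasurableSpace Ω]
  [NormedAddCommGroup E] [InnerProductSpace ℝ E] [CompleteSpace E] [MeasurableSpace E]

/-! ### Exponential families and Bregman divergences

An exponential family is given by a base measure `ρ` (the measure `h(x) dx`) on the observation
space `𝒳` and a feature function `F : 𝒳 → E`. -/

/-- The log-partition function `L(θ) = log ∫ h(x) exp ⟨θ, F x⟩ dx`. -/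
def logPartition (ρ : Measure 𝒳) (F : 𝒳 → E) (θ : E) : ℝ :=
  Real.log (∫ x, Real.exp (inner ℝ θ (F x)) ∂ρ)

/-- The domain `{θ | L(θ) < ∞}` of the log-partition function. -/
def naturalDomain (ρ : Measure 𝒳) (F : 𝒳 → E) : Set E :=
  {θ | Integrable (fun x => Real.exp (inner ℝ θ (F x))) ρ}

/-- The member `p_θ = h(x) exp (⟨θ, F x⟩ - L(θ)) dx` of the exponential family. -/
def expFamily (ρ : Measure 𝒳) (F : 𝒳 → E) (θ : E) : Measure 𝒳 :=
  ρ.withDensity fun x => ENNReal.ofReal (Real.exp (inner ℝ θ (F x) - logPartition ρ F θ))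

/-- The Bregman divergence `B_L(θ', θ) = L(θ') - L(θ) - ⟨θ' - θ, ∇L(θ)⟩`. -/
def bregmanDiv (L : E → ℝ) (θ' θ : E) : ℝ :=
  L θ' - L θ - inner ℝ (θ' - θ) (gradient L θ)

/-- The regularized mean feature `(∑_{t<n} F(x_t) + c ∇L(θ₀)) / (n + c)`. -/
def regularizedMean (ρ : Measure 𝒳) (F : 𝒳 → E) (c : ℝ) (n : ℕ) (x : ℕ → 𝒳) (θ₀ : E) : E :=
  ((n : ℝ) + c)⁻¹ •
    ((∑ t ∈ Finset.range n, F (x t)) + c • gradient (logPartition ρ F) θ₀)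

/-- The estimate `θ_{n,c}(θ₀) = (∇L)⁻¹ (regularized mean feature)`. -/
def estimate (ρ : Measure 𝒳) (F : 𝒳 → E) (c : ℝ) (n : ℕ) (x : ℕ → 𝒳) (θ₀ : E) : E :=
  Function.invFunOn (gradient (logPartition ρ F)) (naturalDomain ρ F)
    (regularizedMean ρ F c n x θ₀)

/-- The integral `∫ exp (- a B_L(θ', θ)) dν(θ')`, where `ν` is Lebesgue or counting measure on the
parameter set. -/
def bregmanIntegral (ρ : Measure 𝒳) (F : 𝒳 → E) (ν : Measure E) (a : ℝ) (θ : E) : ℝ :=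
  ∫ θ', Real.exp (-a * bregmanDiv (logPartition ρ F) θ' θ) ∂ν

/-- The Bregman information gain `γ_{n,c}(θ₀)`. -/
def bregmanGain (ρ : Measure 𝒳) (F : 𝒳 → E) (ν : Measure E) (c : ℝ) (n : ℕ) (x : ℕ → 𝒳)
    (θ₀ : E) : ℝ :=
  Real.log (bregmanIntegral ρ F ν c θ₀ /
    bregmanIntegral ρ F ν ((n : ℝ) + c) (estimate ρ F c n x θ₀))

/-- The Bregman confidence set `Θ_{n,c}(δ)` built from the observations `x_0, …, x_{n-1}`. -/
def confidenceSet (ρ : Measure 𝒳) (F : 𝒳 → E) (Θ : Set E) (ν : Measure E) (c δ : ℝ) (n : ℕ)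
    (x : ℕ → 𝒳) : Set E :=
  {θ₀ | θ₀ ∈ Θ ∧
    ((n : ℝ) + c) * bregmanDiv (logPartition ρ F) θ₀ (estimate ρ F c n x θ₀) ≤
      Real.log (1 / δ) + bregmanGain ρ F ν c n x θ₀}

/-- The estimate and the information gain exist: the regularized mean feature has exactly one
preimage under `∇L`, and both integrals in the gain are finite and positive. -/
def GainWellDefined (ρ : Measure 𝒳) (F : 𝒳 → E) (ν : Measure E) (c : ℝ) (n : ℕ) (x : ℕ → 𝒳)
    (θ₀ : E) : Prop :=
  (∃! θ, θ ∈ naturalDomain ρ F ∧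
    gradient (logPartition ρ F) θ = regularizedMean ρ F c n x θ₀) ∧
  Integrable (fun θ' => Real.exp (-c * bregmanDiv (logPartition ρ F) θ' θ₀)) ν ∧
  Integrable (fun θ' => Real.exp (-((n : ℝ) + c) *
    bregmanDiv (logPartition ρ F) θ' (estimate ρ F c n x θ₀))) ν ∧
  0 < bregmanIntegral ρ F ν c θ₀ ∧
  0 < bregmanIntegral ρ F ν ((n : ℝ) + c) (estimate ρ F c n x θ₀)

/-- `ExplicitSet P ρ F Θ ν c δ D θ supp gain ineq` says, for the distribution `D` on `𝒳`:
`D` is the member with parameter `θ ∈ Θ` of the exponential family `(ρ, F)`, and it is carried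
by `supp`; for observations in `supp`, the Bregman information gain at `θ` is well defined and has
the explicit value `gain n x`, and `θ` lies in the Bregman confidence set of level `δ` if and only
if the explicit inequality `ineq n x` holds; and this inequality holds simultaneously for all `n`
with probability at least `1 - δ` for i.i.d. observations with law `D` on `(Ω, P)`. -/
structure ExplicitSet (P : Measure Ω) (ρ : Measure 𝒳) (F : 𝒳 → E) (Θ : Set E) (ν : Measure E)
    (c δ : ℝ) (D : Measure 𝒳) (θ : E) (supp : Set 𝒳)
    (gain : ℕ → (ℕ → 𝒳) → ℝ) (ineq : ℕ → (ℕ → 𝒳) → Prop) : Prop where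
  subset_domain : Θ ⊆ naturalDomain ρ F
  mem : θ ∈ Θ
  law_eq : D = expFamily ρ F θ
  support : ∀ᵐ y ∂D, y ∈ supp
  well_defined : ∀ (n : ℕ) (x : ℕ → 𝒳), (∀ t < n, x t ∈ supp) → GainWellDefined ρ F ν c n x θ
  gain_eq : ∀ (n : ℕ) (x : ℕ → 𝒳), (∀ t < n, x t ∈ supp) →
    bregmanGain ρ F ν c n x θ = gain n x
  mem_iff : ∀ (n : ℕ) (x : ℕ → 𝒳), (∀ t < n, x t ∈ supp) →
    (θ ∈ confidenceSet ρ F Θ ν c δ n x ↔ ineq n x)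
  coverage : ∀ X : ℕ → Ω → 𝒳, (∀ t, HasLaw (X t) D P) → iIndepFun X P →
    P {ω | ∃ n : ℕ, ¬ ineq n (fun t => X t ω)} ≤ ENNReal.ofReal δ

end Generic

/-! ### Statistics and special functions -/

/-- `S_n = ∑_{t<n} x_t`. -/
def S (n : ℕ) (x : ℕ → ℝ) : ℝ := ∑ t ∈ Finset.range n, x t

/-- `Q_n(μ) = ∑_{t<n} (x_t - μ)²`. -/
def Q (μ : ℝ) (n : ℕ) (x : ℕ → ℝ) : ℝ := ∑ t ∈ Finset.range n, (x t - μ) ^ 2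

/-- `Z_n(μ, σ) = Q_n(μ) / σ²`. -/
def Z (μ σ : ℝ) (n : ℕ) (x : ℕ → ℝ) : ℝ := Q μ n x / σ ^ 2

/-- `(n/(n+c)) Z_n(μ̂_n, σ) + (c/(n+c)) Z_n(μ, σ) + c` with `μ̂_n = S_n / n`; the first term is `0`
for `n = 0`. -/
def W (c μ σ : ℝ) (n : ℕ) (x : ℕ → ℝ) : ℝ :=
  n / (n + c) * Z (S n x / n) σ n x + c / (n + c) * Z μ σ n x + c

/-- `S_n^{(k)} = ∑_{t<n} x_t ^ k`. -/
def Spow (k : ℝ) (n : ℕ) (x : ℕ → ℝ) : ℝ := ∑ t ∈ Finset.range n, x t ^ k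

/-- `L_n = ∑_{t<n} log x_t`. -/
def Llog (n : ℕ) (x : ℕ → ℝ) : ℝ := ∑ t ∈ Finset.range n, Real.log (x t)

/-- `K_n = ∑_{t<n} log (x_t / 2)`. -/
def K (n : ℕ) (x : ℕ → ℝ) : ℝ := ∑ t ∈ Finset.range n, Real.log (x t / 2)

/-- The digamma function `ψ₀ = (log Γ)'`. -/
def digamma (x : ℝ) : ℝ := deriv (fun y => Real.log (Real.Gamma y)) x

/-- `I(a, b) = ∫ exp (- a e^θ + b θ) dθ` over the real line. -/
def I (a b : ℝ) : ℝ := ∫ θ : ℝ, Real.exp (-a * Real.exp θ + b * θ)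

/-- `J(a, b) = ∫ exp (- a log Γ(k/2) + b k / 2) dk` over `k > 0`, for Lebesgue measure. -/
def J (a b : ℝ) : ℝ :=
  ∫ k in Set.Ioi (0 : ℝ), Real.exp (-a * Real.log (Real.Gamma (k / 2)) + b * (k / 2))

/-- `J(a, b) = ∑ exp (- a log Γ(k/2) + b k / 2)` over the integers `k = j + 1 ≥ 1`. -/
def JNat (a b : ℝ) : ℝ :=
  ∑' j : ℕ, Real.exp (-a * Real.log (Real.Gamma (((j : ℝ) + 1) / 2)) + b * (((j : ℝ) + 1) / 2))

/-- The estimate `k_{n,c}(k)`, given by `ψ₀(k_{n,c}(k) / 2) = (K_n + c ψ₀(k / 2)) / (n + c)`. -/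
def chiSqEstimate (c : ℝ) (n : ℕ) (x : ℕ → ℝ) (k : ℝ) : ℝ :=
  2 * Function.invFunOn digamma (Set.Ioi 0) ((K n x + c * digamma (k / 2)) / (n + c))

/-! ### Distributions and parameter sets -/

/-- The Weibull distribution with scale `l` and shape `k`. -/
def weibullMeasure (l k : ℝ) : Measure ℝ :=
  volume.withDensity fun x => ENNReal.ofReal
    (if 0 ≤ x then k / l * (x / l) ^ (k - 1) * Real.exp (-(x / l) ^ k) else 0)

/-- The chi-square distribution with `k` degrees of freedom: Gamma with shape `k/2`, rate `1/2`. -/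
def chiSqMeasure (k : ℝ) : Measure ℝ := gammaMeasure (k / 2) (1 / 2)

/-- The natural parameters `k/2 - 1`, `k = 1, 2, 3, …`, of the chi-square distributions. -/
def chiSqParams : Set ℝ := {θ | ∃ k : ℕ, 1 ≤ k ∧ θ = (k : ℝ) / 2 - 1}

/-- The natural parameters of the two-parameter Gaussian family. -/
def gaussParams : Set (EuclideanSpace ℝ (Fin 2)) := {θ | θ 1 < 0}

end BregmanCS

end

/-!
Confidence sets for exponential families from mixtures of likelihood ratios.

Let `B` be the Bregman divergence of the log-partition function `L` and `θ_n` the estimate, at which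
`∇L` is the regularized mean feature. Completing the Bregman divergence, as one completes a square,
gives (`neg_mul_bregmanDiv_add_sum`)

  `-c B(θ', θ₀) + log (likelihood ratio of θ' against θ₀) = (n + c) (B(θ₀, θ_n) - B(θ', θ_n))`.

Integrating the exponential of this over `θ'` shows that the mixture of the likelihood ratios with
the normalized weight `exp (-c B(θ', θ₀))` equals `exp ((n + c) B(θ₀, θ_n) - γ_n)`, where `γ_n` is
the Bregman information gain. So `θ₀` leaves the confidence set exactly when the mixture exceeds
`1 / δ`. The mixture is a nonnegative martingale of initial value `1`, and by Ville's inequality it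
ever exceeds `1 / δ` with probability at most `δ`. For i.i.d. observations this needs no conditional
expectations: conditioning on the first observation turns one mixing measure into another one, so
that an induction on the number of observations proves the bound
(`pi_exists_one_le_lintegral_prod_le`, `measure_exists_notMem_confidenceSet_le`).

What remains for each distribution is a computation, organized by
`ExplicitSet.of_isExplicitFamily`: the log-partition function and its natural domain, the inverse of
its gradient, and the integrals `∫ exp (-a B(θ', θ)) dν(θ')`. Where these are evaluated in closed
form, and so everywhere but for the chi-square family, their finiteness comes for free, since
the Bochner integral of a non-integrable function is `0` while the values found are positive.

* Five of the families have `L(θ) = C - κ log (τ - θ)`, and the integral is a Gamma integral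
  (`ExplicitSet.of_log`).
* For the Bernoulli and Poisson families the substitutions by the sigmoid and by the exponential
  function lead to Beta and Gamma integrals.
* For the chi-square family `L` is `log Γ` up to a linear function. Its derivative is strictly
  increasing and onto the real line by the functional equation of `Γ` and the convexity of `log Γ`
  (`strictMonoOn_digamma`, `exists_digamma_eq`); convexity also bounds the integrands of `J` and
  `JNat` by decaying exponentials (`exists_exp_log_Gamma_le`).
* For the two-parameter Gaussian family, integrating out the first natural parameter is a Gaussian
  integral, and a Gamma integral in the second one remains (`integral_prod_exp_gauss`).
-/

namespace BregmanCS

open scoped ENNReal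

/-! ### Ville's inequality for mixtures of likelihood ratios -/

section Ville

variable {𝒳 E Ω : Type*} [MeasurableSpace 𝒳] [MeasurableSpace E] [MeasurableSpace Ω]

/-- Ville's inequality for a mixture of likelihood ratios over finitely many i.i.d. observations.
The induction on the number of observations conditions on the first one, `y`, which replaces the
mixing measure `π` by `π.withDensity (p · y)`; the average total mass of the latter is at most that
of `π`. -/
lemma pi_exists_one_le_lintegral_prod_le (D : Measure 𝒳) [IsProbabilityMeasure D]
    (p : E → 𝒳 → ℝ≥0∞) (hp : Measurable (Function.uncurry p)) (N : ℕ) :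
    ∀ (π : Measure E) [SFinite π], (∀ᵐ θ ∂π, ∫⁻ y, p θ y ∂D ≤ 1) →
      Measure.pi (fun _ : Fin N => D)
        {x | ∃ k ≤ N, 1 ≤ ∫⁻ θ, ∏ t : Fin N, (if t.val < k then p θ (x t) else 1) ∂π}
        ≤ π Set.univ := by
  induction N with
  | zero =>
    intro π _ _
    by_cases h : 1 ≤ π Set.univ
    · exact prob_le_one.trans h
    · have : {x : Fin 0 → 𝒳 | ∃ k ≤ 0, 1 ≤ ∫⁻ θ, ∏ t : Fin 0,
          (if t.val < k then p θ (x t) else 1) ∂π} = ∅ := by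
        ext x
        simpa using h
      rw [this]
      simp
  | succ N ih =>
    intro π _ hπ
    by_cases h : 1 ≤ π Set.univ
    · exact prob_le_one.trans h
    -- now the level is not reached before the first observation
    let B : Set (𝒳 × (Fin N → 𝒳)) := {z | ∃ k ≤ N, 1 ≤ ∫⁻ θ,
      p θ z.1 * ∏ t : Fin N, (if t.val < k then p θ (z.2 t) else 1) ∂π}
    have hmeas : ∀ k : ℕ, Measurable fun z : (𝒳 × (Fin N → 𝒳)) × E =>
        p z.2 z.1.1 * ∏ t : Fin N, (if t.val < k then p z.2 (z.1.2 t) else 1) := by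
      intro k
      refine Measurable.mul (hp.comp (by fun_prop : Measurable fun z : (𝒳 × (Fin N → 𝒳)) × E =>
        (z.2, z.1.1))) ?_
      refine Finset.measurable_prod _ fun t _ => ?_
      split_ifs
      · exact hp.comp (by fun_prop : Measurable fun z : (𝒳 × (Fin N → 𝒳)) × E =>
          (z.2, z.1.2 t))
      · exact measurable_const
    have hB : MeasurableSet B := by
      have : B = ⋃ k ∈ Set.Iic N, {z | 1 ≤ ∫⁻ θ,
          p θ z.1 * ∏ t : Fin N, (if t.val < k then p θ (z.2 t) else 1) ∂π} := by
        ext z; simp [B]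
      rw [this]
      refine MeasurableSet.biUnion (Set.to_countable _) fun k _ => ?_
      exact measurableSet_le measurable_const (hmeas k).lintegral_prod_right'
    have hsub : {x : Fin (N + 1) → 𝒳 | ∃ k ≤ N + 1, 1 ≤ ∫⁻ θ, ∏ t : Fin (N + 1),
          (if t.val < k then p θ (x t) else 1) ∂π} ⊆
        MeasurableEquiv.piFinSuccAbove (fun _ : Fin (N + 1) => 𝒳) 0 ⁻¹' B := by
      rintro x ⟨k, hk, hx⟩
      rcases k with _ | k
      · exact absurd (by simpa using hx) h
      · refine ⟨k, by omega, ?_⟩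
        simpa [Fin.prod_univ_succ, MeasurableEquiv.piFinSuccAbove, Fin.removeNth, Fin.tail]
          using hx
    calc _ ≤ Measure.pi (fun _ : Fin (N + 1) => D)
            (MeasurableEquiv.piFinSuccAbove (fun _ : Fin (N + 1) => 𝒳) 0 ⁻¹' B) :=
          measure_mono hsub
      _ = (D.prod (Measure.pi fun _ : Fin N => D)) B :=
          (measurePreserving_piFinSuccAbove (fun _ : Fin (N + 1) => D) 0).measure_preimage
            hB.nullMeasurableSet
      _ = ∫⁻ y, Measure.pi (fun _ : Fin N => D) (Prod.mk y ⁻¹' B) ∂D :=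
          Measure.prod_apply hB
      _ ≤ ∫⁻ y, ∫⁻ θ, p θ y ∂π ∂D := by
          refine lintegral_mono fun y => ?_
          have hy : Measurable fun θ => p θ y :=
            hp.comp (by fun_prop : Measurable fun θ : E => (θ, y))
          have key := ih (π.withDensity fun θ => p θ y)
            ((withDensity_absolutelyContinuous _ _).ae_le hπ)
          rw [withDensity_apply _ MeasurableSet.univ, Measure.restrict_univ] at key
          refine le_trans (le_of_eq ?_) key
          congr 1
          ext x
          simp only [B, Set.mem_preimage, Set.mem_ofPred_eq]
          refine exists_congr fun k => and_congr_right fun _ => ?_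
          rw [lintegral_withDensity_eq_lintegral_mul _ hy]
          · rfl
          · refine Finset.measurable_prod _ fun t _ => ?_
            split_ifs
            · exact hp.comp (by fun_prop : Measurable fun θ : E => (θ, x t))
            · exact measurable_const
      _ = ∫⁻ θ, ∫⁻ y, p θ y ∂D ∂π := by
          rw [lintegral_lintegral_swap]
          exact (hp.comp measurable_swap).aemeasurable
      _ ≤ ∫⁻ _, 1 ∂π := lintegral_mono_ae hπ
      _ = π Set.univ := by simp

/-- Ville's inequality for a mixture of likelihood ratios over an i.i.d. sequence. -/
lemma measure_exists_one_le_lintegral_prod_le (P : Measure Ω) [IsProbabilityMeasure P]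
    (D : Measure 𝒳) [IsProbabilityMeasure D] (p : E → 𝒳 → ℝ≥0∞)
    (hp : Measurable (Function.uncurry p)) (π : Measure E) [SFinite π]
    (hπ : ∀ᵐ θ ∂π, ∫⁻ y, p θ y ∂D ≤ 1) (X : ℕ → Ω → 𝒳) (hX : ∀ t, HasLaw (X t) D P)
    (hind : iIndepFun X P) :
    P {ω | ∃ n : ℕ, 1 ≤ ∫⁻ θ, ∏ t ∈ Finset.range n, p θ (X t ω) ∂π} ≤ π Set.univ := by
  set A : ℕ → Set Ω := fun N =>
    {ω | ∃ n ≤ N, 1 ≤ ∫⁻ θ, ∏ t ∈ Finset.range n, p θ (X t ω) ∂π} with hA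
  have hU : {ω | ∃ n : ℕ, 1 ≤ ∫⁻ θ, ∏ t ∈ Finset.range n, p θ (X t ω) ∂π} = ⋃ N, A N := by
    ext ω
    simp only [hA, Set.mem_ofPred_eq, Set.mem_iUnion]
    constructor
    · rintro ⟨n, hn⟩
      exact ⟨n, n, le_rfl, hn⟩
    · rintro ⟨N, n, -, hn⟩
      exact ⟨n, hn⟩
  have hmono : Monotone A := by
    rintro M N h ω ⟨n, hn, h'⟩
    exact ⟨n, hn.trans h, h'⟩
  rw [hU, hmono.measure_iUnion]
  refine iSup_le fun N => ?_
  have hmap : P.map (fun ω (i : Fin N) => X i ω) = Measure.pi fun _ : Fin N => D := by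
    have h := (iIndepFun_iff_map_fun_eq_pi_map
      (fun i : Fin N => (hX i).aemeasurable)).1 (hind.precomp Fin.val_injective)
    rw [h]
    congr 1
    funext i
    exact (hX i).map_eq
  refine le_trans ?_ (pi_exists_one_le_lintegral_prod_le D p hp N π hπ)
  rw [← hmap]
  refine le_trans (le_of_eq ?_)
    (Measure.le_map_apply (f := fun ω (i : Fin N) => X i ω)
      (aemeasurable_pi_lambda _ fun i => (hX i).aemeasurable) _)
  congr 1
  ext ω
  simp only [hA, Set.mem_ofPred_eq, Set.mem_preimage]
  refine exists_congr fun k => and_congr_right fun hk => ?_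
  have : ∀ θ, ∏ t : Fin N, (if t.val < k then p θ (X t ω) else 1)
      = ∏ t ∈ Finset.range k, p θ (X t ω) := fun θ => by
    rw [← Finset.prod_range fun t => if t < k then p θ (X t ω) else 1, ← Finset.prod_filter]
    congr 1
    ext t
    simp only [Finset.mem_filter, Finset.mem_range]
    omega
  simp only [this]

end Ville

/-! ### Coverage of Bregman confidence sets -/

section Coverage

variable {𝒳 E Ω : Type*} [MeasurableSpace 𝒳] [MeasurableSpace Ω]
  [NormedAddCommGroup E] [InnerProductSpace ℝ E]

lemma measurable_logPartition [MeasurableSpace E] [BorelSpace E] [SecondCountableTopology E]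
    (ρ : Measure 𝒳) [SFinite ρ] {F : 𝒳 → E} (hF : Measurable F) :
    Measurable (logPartition ρ F) := by
  refine Real.measurable_log.comp ?_
  refine StronglyMeasurable.measurable ?_
  refine StronglyMeasurable.integral_prod_right
    (f := fun (θ : E) (x : 𝒳) => Real.exp (inner ℝ θ (F x))) ?_
  have : Measurable fun z : E × 𝒳 => inner ℝ z.1 (F z.2) :=
    measurable_fst.inner (hF.comp measurable_snd)
  exact (Real.measurable_exp.comp this).stronglyMeasurable

lemma exp_logPartition (ρ : Measure 𝒳) [NeZero ρ] (F : 𝒳 → E) {θ : E}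
    (hθ : θ ∈ naturalDomain ρ F) :
    Real.exp (logPartition ρ F θ) = ∫ x, Real.exp (inner ℝ θ (F x)) ∂ρ :=
  Real.exp_log (integral_exp_pos hθ)

/-- If the estimate exists, `(n + c) (B(θ₀, θ_n) - B(θ', θ_n))` is the logarithm of the likelihood
ratio of `θ'` against `θ₀`, weighted by `exp (-c B(θ', θ₀))`. -/
lemma neg_mul_bregmanDiv_add_sum [CompleteSpace E] (ρ : Measure 𝒳) (F : 𝒳 → E) {c : ℝ}
    (hc : 0 < c) (n : ℕ) (x : ℕ → 𝒳) (θ₀ θ' : E)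
    (h : gradient (logPartition ρ F) (estimate ρ F c n x θ₀) = regularizedMean ρ F c n x θ₀) :
    -c * bregmanDiv (logPartition ρ F) θ' θ₀ + ∑ t ∈ Finset.range n,
        (inner ℝ (θ' - θ₀) (F (x t)) - logPartition ρ F θ' + logPartition ρ F θ₀)
      = ((n : ℝ) + c) * bregmanDiv (logPartition ρ F) θ₀ (estimate ρ F c n x θ₀)
        + -((n : ℝ) + c) * bregmanDiv (logPartition ρ F) θ' (estimate ρ F c n x θ₀) := by
  have hnc : (n : ℝ) + c ≠ 0 := by positivity
  have e : ((n : ℝ) + c) * inner ℝ (θ' - θ₀)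
      (gradient (logPartition ρ F) (estimate ρ F c n x θ₀))
      = ∑ t ∈ Finset.range n, inner ℝ (θ' - θ₀) (F (x t))
        + c * inner ℝ (θ' - θ₀) (gradient (logPartition ρ F) θ₀) := by
    rw [h, regularizedMean, inner_smul_right, inner_add_right, inner_smul_right, inner_sum,
      mul_inv_cancel_left₀ hnc]
  have e2 : inner ℝ (θ' - θ₀) (gradient (logPartition ρ F) (estimate ρ F c n x θ₀))
      = inner ℝ (θ' - estimate ρ F c n x θ₀)
          (gradient (logPartition ρ F) (estimate ρ F c n x θ₀))
        - inner ℝ (θ₀ - estimate ρ F c n x θ₀)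
          (gradient (logPartition ρ F) (estimate ρ F c n x θ₀)) := by
    rw [← inner_sub_left]; congr 1; abel
  rw [e2] at e
  simp only [bregmanDiv, Finset.sum_add_distrib, Finset.sum_sub_distrib, Finset.sum_const,
    Finset.card_range, nsmul_eq_mul]
  linarith

/-- The Bregman confidence sets contain the true parameter simultaneously for all `n` with
probability at least `1 - δ`: leaving the confidence set means that a mixture of likelihood ratios
of initial value `1` exceeds `1 / δ`. -/
theorem measure_exists_notMem_confidenceSet_le [CompleteSpace E] [MeasurableSpace E]
    [BorelSpace E] [SecondCountableTopology E]
    (P : Measure Ω) [IsProbabilityMeasure P] (ρ : Measure 𝒳) [SFinite ρ] {F : 𝒳 → E}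
    (hF : Measurable F) {Θ : Set E} (ν : Measure E) [SFinite ν]
    (hν : ∀ᵐ θ' ∂ν, θ' ∈ naturalDomain ρ F) {c δ : ℝ} (hc : 0 < c) (hδ : 0 < δ) {θ : E}
    (hθ : θ ∈ Θ) {supp : Set 𝒳}
    (hwd : ∀ (n : ℕ) (x : ℕ → 𝒳), (∀ t < n, x t ∈ supp) → GainWellDefined ρ F ν c n x θ)
    (X : ℕ → Ω → 𝒳) (hX : ∀ t, HasLaw (X t) (expFamily ρ F θ) P) (hind : iIndepFun X P) :
    P {ω | ∃ n : ℕ, (∀ t < n, X t ω ∈ supp) ∧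
      θ ∉ confidenceSet ρ F Θ ν c δ n (fun t => X t ω)} ≤ ENNReal.ofReal δ := by
  set Λ := logPartition ρ F with hΛ
  have hΛm : Measurable Λ := measurable_logPartition ρ hF
  have hD : IsProbabilityMeasure (expFamily ρ F θ) := by
    rw [← (hX 0).map_eq]
    exact Measure.isProbabilityMeasure_map (hX 0).aemeasurable
  have hρ : NeZero ρ := by
    refine ⟨fun h => ?_⟩
    have := hD.measure_univ
    simp [expFamily, h] at this
  have hinm : Measurable fun z : E × 𝒳 => inner ℝ (z.1 - θ) (F z.2) :=
    (measurable_fst.sub_const θ).inner (hF.comp measurable_snd)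
  let p : E → 𝒳 → ℝ≥0∞ := fun θ' y =>
    ENNReal.ofReal (Real.exp (inner ℝ (θ' - θ) (F y) - Λ θ' + Λ θ))
  have hp : Measurable (Function.uncurry p) := by
    refine ENNReal.measurable_ofReal.comp (Real.measurable_exp.comp ?_)
    exact (hinm.sub (hΛm.comp measurable_fst)).add_const _
  have hp1 : ∀ᵐ θ' ∂ν, ∫⁻ y, p θ' y ∂(expFamily ρ F θ) ≤ 1 := by
    filter_upwards [hν] with θ' hθ'
    have hm1 : Measurable fun x => ENNReal.ofReal (Real.exp (inner ℝ θ (F x) - Λ θ)) :=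
      ENNReal.measurable_ofReal.comp (Real.measurable_exp.comp
        ((measurable_const.inner hF).sub_const _))
    have hm2 : Measurable fun y => p θ' y :=
      hp.comp (by fun_prop : Measurable fun y : 𝒳 => (θ', y))
    rw [expFamily, lintegral_withDensity_eq_lintegral_mul _ hm1 hm2]
    have : ∀ y, ((fun x => ENNReal.ofReal (Real.exp (inner ℝ θ (F x) - Λ θ))) * fun y => p θ' y) y
        = ENNReal.ofReal (Real.exp (-Λ θ')) * ENNReal.ofReal (Real.exp (inner ℝ θ' (F y))) := by
      intro y
      simp only [Pi.mul_apply, p]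
      rw [← ENNReal.ofReal_mul (Real.exp_nonneg _), ← ENNReal.ofReal_mul (Real.exp_nonneg _),
        ← Real.exp_add, ← Real.exp_add, inner_sub_left]
      congr 2
      ring
    have hm3 : Measurable fun y => ENNReal.ofReal (Real.exp (inner ℝ θ' (F y))) :=
      ENNReal.measurable_ofReal.comp (Real.measurable_exp.comp (measurable_const.inner hF))
    rw [lintegral_congr this, lintegral_const_mul _ hm3,
      ← ofReal_integral_eq_lintegral_ofReal hθ' (ae_of_all _ fun _ => Real.exp_nonneg _),
      ← exp_logPartition ρ F hθ', ← ENNReal.ofReal_mul (Real.exp_nonneg _), ← Real.exp_add]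
    simp [hΛ]
  have hΩ : Nonempty Ω := P.nonempty_of_neZero
  obtain ⟨-, hI0, -, hG0, -⟩ := hwd 0 (fun t => X t hΩ.some) (by simp)
  set G₀ := bregmanIntegral ρ F ν c θ with hG₀
  -- the mixing measure has total mass `δ`, so that the level to be crossed is `1`
  let w : E → ℝ := fun θ' => δ / G₀ * Real.exp (-c * bregmanDiv Λ θ' θ)
  have hBm : ∀ η, Measurable fun θ' => bregmanDiv Λ θ' η := fun η =>
    (hΛm.sub_const _).sub ((measurable_id.sub_const η).inner measurable_const)
  have hwm : Measurable fun θ' => ENNReal.ofReal (w θ') :=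
    ENNReal.measurable_ofReal.comp
      ((Real.measurable_exp.comp ((hBm θ).const_mul _)).const_mul _)
  have hw0 : ∀ θ', 0 ≤ w θ' := fun θ' => by positivity
  let π : Measure E := ν.withDensity fun θ' => ENNReal.ofReal (w θ')
  have hπ : π Set.univ = ENNReal.ofReal δ := by
    rw [withDensity_apply _ MeasurableSet.univ, Measure.restrict_univ,
      ← ofReal_integral_eq_lintegral_ofReal (hI0.const_mul _) (ae_of_all _ hw0),
      integral_const_mul]
    congr 1
    exact div_mul_cancel₀ δ hG0.ne'
  have hville := measure_exists_one_le_lintegral_prod_le P (expFamily ρ F θ) p hp π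
    ((withDensity_absolutelyContinuous _ _).ae_le hp1) X hX hind
  rw [hπ] at hville
  refine le_trans (measure_mono ?_) hville
  rintro ω ⟨n, hn, hnot⟩
  refine ⟨n, ?_⟩
  set x : ℕ → 𝒳 := fun t => X t ω with hx
  obtain ⟨hex, -, hI, -, hG⟩ := hwd n x hn
  have hgrad : gradient Λ (estimate ρ F c n x θ) = regularizedMean ρ F c n x θ :=
    Function.invFunOn_eq hex.exists
  set η := estimate ρ F c n x θ with hη
  have hnc : 0 < (n : ℝ) + c := by positivity
  have hprod : ∀ θ', ENNReal.ofReal (w θ') * ∏ t ∈ Finset.range n, p θ' (x t)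
      = ENNReal.ofReal (δ / G₀ * Real.exp (((n : ℝ) + c) * bregmanDiv Λ θ η)
          * Real.exp (-((n : ℝ) + c) * bregmanDiv Λ θ' η)) := by
    intro θ'
    simp only [p, w]
    rw [← ENNReal.ofReal_prod_of_nonneg fun _ _ => Real.exp_nonneg _, ← Real.exp_sum,
      ← ENNReal.ofReal_mul (hw0 θ'), mul_assoc, mul_assoc, ← Real.exp_add, ← Real.exp_add,
      neg_mul_bregmanDiv_add_sum ρ F hc n x θ θ' hgrad]
  have hpm : Measurable fun θ' => ∏ t ∈ Finset.range n, p θ' (x t) :=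
    Finset.measurable_prod _ fun t _ => hp.comp (by fun_prop : Measurable fun θ' : E => (θ', x t))
  rw [lintegral_withDensity_eq_lintegral_mul _ hwm hpm]
  simp only [Pi.mul_apply]
  rw [lintegral_congr hprod, ← ofReal_integral_eq_lintegral_ofReal (hI.const_mul _)
    (ae_of_all _ fun _ => by positivity), integral_const_mul, ENNReal.one_le_ofReal]
  have hlt : Real.log (1 / δ) + Real.log (G₀ / bregmanIntegral ρ F ν ((n : ℝ) + c) η)
      < ((n : ℝ) + c) * bregmanDiv Λ θ η := by
    by_contra hle
    exact hnot ⟨hθ, not_lt.1 hle⟩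
  rw [← Real.log_mul (by positivity) (by positivity), Real.log_lt_iff_lt_exp (by positivity)]
    at hlt
  change 1 ≤ δ / G₀ * Real.exp (((n : ℝ) + c) * bregmanDiv Λ θ η) *
    bregmanIntegral ρ F ν ((n : ℝ) + c) η
  calc (1 : ℝ) = δ / G₀ * (1 / δ * (G₀ / bregmanIntegral ρ F ν ((n : ℝ) + c) η))
        * bregmanIntegral ρ F ν ((n : ℝ) + c) η := by
        field_simp
    _ ≤ _ := by gcongr

end Coverage

/-! ### Exponential families given by closed formulas -/

/-- The exponential family `(ρ, F)` has natural domain the open set `T`, log-partition function `A`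
on it, and `∇A = g` there, with `g` injective. -/
structure IsExplicitFamily {𝒳 E : Type*} [MeasurableSpace 𝒳] [NormedAddCommGroup E]
    [InnerProductSpace ℝ E] [CompleteSpace E] (ρ : Measure 𝒳) (F : 𝒳 → E) (T : Set E)
    (A : E → ℝ) (g : E → E) : Prop where
  isOpen : IsOpen T
  integral_eq : ∀ θ ∈ T, ∫ x, Real.exp (inner ℝ θ (F x)) ∂ρ = Real.exp (A θ)
  not_integrable : ∀ θ ∉ T, ¬ Integrable (fun x => Real.exp (inner ℝ θ (F x))) ρ
  hasGradientAt : ∀ θ ∈ T, HasGradientAt A (g θ) θ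
  injOn : Set.InjOn g T

section

variable {𝒳 E Ω : Type*} [MeasurableSpace 𝒳] [MeasurableSpace Ω] [NormedAddCommGroup E]
    [InnerProductSpace ℝ E] [CompleteSpace E] {ρ : Measure 𝒳} {F : 𝒳 → E} {T : Set E}
    {A : E → ℝ} {g : E → E}

namespace IsExplicitFamily

lemma integrable (h : IsExplicitFamily ρ F T A g) {θ : E} (hθ : θ ∈ T) :
    Integrable (fun x => Real.exp (inner ℝ θ (F x))) ρ :=
  Integrable.of_integral_ne_zero (by rw [h.integral_eq θ hθ]; positivity)

lemma naturalDomain_eq (h : IsExplicitFamily ρ F T A g) : naturalDomain ρ F = T := by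
  ext θ
  by_cases hθ : θ ∈ T
  · exact ⟨fun _ => hθ, fun _ => h.integrable hθ⟩
  · exact ⟨fun h' => absurd h' (h.not_integrable θ hθ), fun h' => absurd h' hθ⟩

lemma logPartition_eq (h : IsExplicitFamily ρ F T A g) {θ : E} (hθ : θ ∈ T) :
    logPartition ρ F θ = A θ := by
  rw [logPartition, h.integral_eq θ hθ, Real.log_exp]

lemma gradient_logPartition (h : IsExplicitFamily ρ F T A g) {θ : E} (hθ : θ ∈ T) :
    gradient (logPartition ρ F) θ = g θ := by
  refine HasGradientAt.gradient ((h.hasGradientAt θ hθ).congr_of_eventuallyEq ?_)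
  filter_upwards [h.isOpen.mem_nhds hθ] with θ' hθ' using h.logPartition_eq hθ'

lemma bregmanDiv_eq (h : IsExplicitFamily ρ F T A g) {θ' θ : E} (hθ' : θ' ∈ T) (hθ : θ ∈ T) :
    bregmanDiv (logPartition ρ F) θ' θ = A θ' - A θ - inner ℝ (θ' - θ) (g θ) := by
  rw [bregmanDiv, h.logPartition_eq hθ', h.logPartition_eq hθ, h.gradient_logPartition hθ]

lemma expFamily_eq (h : IsExplicitFamily ρ F T A g) {θ : E} (hθ : θ ∈ T) :
    expFamily ρ F θ
      = ρ.withDensity fun x => ENNReal.ofReal (Real.exp (inner ℝ θ (F x) - A θ)) := by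
  rw [expFamily, h.logPartition_eq hθ]

lemma estimate_eq (h : IsExplicitFamily ρ F T A g) {θ η : E} (hθ : θ ∈ T) (hη : η ∈ T) {c : ℝ}
    {n : ℕ} {x : ℕ → 𝒳}
    (hg : g η = ((n : ℝ) + c)⁻¹ • ((∑ t ∈ Finset.range n, F (x t)) + c • g θ)) :
    estimate ρ F c n x θ = η := by
  have hex : ∃ η' ∈ T, gradient (logPartition ρ F) η' = regularizedMean ρ F c n x θ :=
    ⟨η, hη, by rw [h.gradient_logPartition hη, regularizedMean, h.gradient_logPartition hθ, hg]⟩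
  rw [estimate, h.naturalDomain_eq]
  have h1 := Function.invFunOn_mem hex
  have h2 := Function.invFunOn_eq hex
  refine h.injOn h1 hη ?_
  rw [h.gradient_logPartition h1] at h2
  rw [h2, regularizedMean, h.gradient_logPartition hθ, hg]

end IsExplicitFamily

/-- Reduction of the explicit form of a confidence set to closed formulas: besides the family, it
takes the estimate `η` and the Bregman integral `G a θ`, which is finite because its value is not
the value `0` of a divergent integral. -/
theorem ExplicitSet.of_isExplicitFamily [MeasurableSpace E] [BorelSpace E]
    [SecondCountableTopology E] {P : Measure Ω} [IsProbabilityMeasure P] [SFinite ρ]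
    (h : IsExplicitFamily ρ F T A g) (hF : Measurable F) {Θ : Set E} (hΘ : Θ ⊆ T) {ν : Measure E}
    [SFinite ν] (hν : ∀ᵐ θ' ∂ν, θ' ∈ Θ) {c δ : ℝ} (hc : 0 < c) (hδ : 0 < δ) {D : Measure 𝒳} {θ : E}
    (hθ : θ ∈ Θ)
    (hD : D = ρ.withDensity fun x => ENNReal.ofReal (Real.exp (inner ℝ θ (F x) - A θ)))
    {supp : Set 𝒳} (hsupp : ∀ᵐ y ∂D, y ∈ supp) {gain : ℕ → (ℕ → 𝒳) → ℝ}
    {ineq : ℕ → (ℕ → 𝒳) → Prop} (η : ℕ → (ℕ → 𝒳) → E) (G : ℝ → E → ℝ)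
    (hη : ∀ (n : ℕ) (x : ℕ → 𝒳), (∀ t < n, x t ∈ supp) → η n x ∈ T ∧
      g (η n x) = ((n : ℝ) + c)⁻¹ • ((∑ t ∈ Finset.range n, F (x t)) + c • g θ))
    (hG : ∀ a : ℝ, 0 < a → ∀ θ ∈ T, 0 < G a θ ∧
      ∫ θ', Real.exp (-a * (A θ' - A θ - inner ℝ (θ' - θ) (g θ))) ∂ν = G a θ)
    (hgain : ∀ (n : ℕ) (x : ℕ → 𝒳), (∀ t < n, x t ∈ supp) →
      Real.log (G c θ / G ((n : ℝ) + c) (η n x)) = gain n x)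
    (hineq : ∀ (n : ℕ) (x : ℕ → 𝒳), (∀ t < n, x t ∈ supp) →
      (((n : ℝ) + c) * (A θ - A (η n x) - inner ℝ (θ - η n x) (g (η n x))) ≤
        Real.log (1 / δ) + gain n x ↔ ineq n x)) :
    ExplicitSet P ρ F Θ ν c δ D θ supp gain ineq := by
  have hθT : θ ∈ T := hΘ hθ
  have hcongr : ∀ a : ℝ, ∀ θ ∈ T, (fun θ' => Real.exp (-a * bregmanDiv (logPartition ρ F) θ' θ))
      =ᵐ[ν] fun θ' => Real.exp (-a * (A θ' - A θ - inner ℝ (θ' - θ) (g θ))) := by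
    intro a θ hθ
    filter_upwards [hν] with θ' hθ'
    rw [h.bregmanDiv_eq (hΘ hθ') hθ]
  have hint : ∀ a : ℝ, 0 < a → ∀ θ ∈ T, bregmanIntegral ρ F ν a θ = G a θ := by
    intro a ha θ hθ
    rw [bregmanIntegral, integral_congr_ae (hcongr a θ hθ), (hG a ha θ hθ).2]
  have hpos : ∀ a : ℝ, 0 < a → ∀ θ ∈ T, 0 < bregmanIntegral ρ F ν a θ := by
    intro a ha θ hθ
    rw [hint a ha θ hθ]
    exact (hG a ha θ hθ).1
  have hnc : ∀ n : ℕ, 0 < (n : ℝ) + c := fun n => by positivity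
  have hest : ∀ (n : ℕ) (x : ℕ → 𝒳), (∀ t < n, x t ∈ supp) → estimate ρ F c n x θ = η n x :=
    fun n x hx => h.estimate_eq hθT (hη n x hx).1 (hη n x hx).2
  have hwd : ∀ (n : ℕ) (x : ℕ → 𝒳), (∀ t < n, x t ∈ supp) → GainWellDefined ρ F ν c n x θ := by
    intro n x hx
    obtain ⟨hηT, hηg⟩ := hη n x hx
    have e : regularizedMean ρ F c n x θ = g (η n x) := by
      rw [regularizedMean, h.gradient_logPartition hθT, hηg]
    refine ⟨⟨η n x, ⟨h.naturalDomain_eq ▸ hηT, ?_⟩, ?_⟩, ?_, ?_, hpos c hc θ hθT, ?_⟩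
    · rw [e, h.gradient_logPartition hηT]
    · rintro η' ⟨hη', hgr⟩
      rw [h.naturalDomain_eq] at hη'
      rw [e, h.gradient_logPartition hη'] at hgr
      exact h.injOn hη' hηT hgr
    · exact Integrable.of_integral_ne_zero (hpos c hc θ hθT).ne'
    · rw [hest n x hx]
      exact Integrable.of_integral_ne_zero (hpos _ (hnc n) _ hηT).ne'
    · rw [hest n x hx]
      exact hpos _ (hnc n) _ hηT
  have hgaineq : ∀ (n : ℕ) (x : ℕ → 𝒳), (∀ t < n, x t ∈ supp) →
      bregmanGain ρ F ν c n x θ = gain n x := by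
    intro n x hx
    rw [bregmanGain, hest n x hx, hint c hc θ hθT, hint _ (hnc n) _ (hη n x hx).1, hgain n x hx]
  have hmem : ∀ (n : ℕ) (x : ℕ → 𝒳), (∀ t < n, x t ∈ supp) →
      (θ ∈ confidenceSet ρ F Θ ν c δ n x ↔ ineq n x) := by
    intro n x hx
    rw [← hineq n x hx]
    change (θ ∈ Θ ∧ _) ↔ _
    rw [hgaineq n x hx, hest n x hx, h.bregmanDiv_eq hθT (hη n x hx).1]
    exact and_iff_right hθ
  have hlaw : D = expFamily ρ F θ := by rw [hD, h.expFamily_eq hθT]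
  refine ⟨h.naturalDomain_eq.symm ▸ hΘ, hθ, hlaw, hsupp, hwd, hgaineq, hmem, ?_⟩
  intro X hX hind
  have hall : ∀ᵐ ω ∂P, ∀ t, X t ω ∈ supp := by
    refine ae_all_iff.2 fun t => ?_
    refine ae_of_ae_map (hX t).aemeasurable ?_
    rw [(hX t).map_eq]
    exact hsupp
  have hcov := measure_exists_notMem_confidenceSet_le P ρ hF (Θ := Θ) ν (c := c)
    (hν.mono fun θ' hθ' => h.naturalDomain_eq.symm ▸ hΘ hθ') hc hδ hθ hwd X
    (fun t => hlaw ▸ hX t) hind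
  refine le_trans (measure_mono_ae ?_) hcov
  filter_upwards [hall] with ω hω
  rintro ⟨n, hn⟩
  exact ⟨n, fun t _ => hω t, fun hmem' => hn ((hmem n _ fun t _ => hω t).1 hmem')⟩

end

/-! ### Families with a logarithmic log-partition function -/

lemma setIntegral_Iio_comp_sub_left (f : ℝ → ℝ) (τ : ℝ) :
    ∫ θ in Set.Iio τ, f (τ - θ) = ∫ u in Set.Ioi 0, f u := by
  rw [← integral_indicator measurableSet_Iio, ← integral_indicator measurableSet_Ioi,
    ← integral_sub_left_eq_self (fun u => (Set.Ioi (0 : ℝ)).indicator f u) volume τ]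
  congr 1
  ext θ
  by_cases h : θ < τ
  · simp [Set.indicator, h]
  · simp [Set.indicator, h]

/-- `∫_{θ' < τ} exp (-a B(θ', θ))` for the log-partition function `-κ log (τ - θ)`. -/
lemma integral_exp_bregman_log {κ τ a θ : ℝ} (C : ℝ) (hκ : 0 < κ) (ha : 0 < a) (hθ : θ < τ) :
    ∫ θ' in Set.Iio τ, Real.exp (-a * ((C - κ * Real.log (τ - θ')) - (C - κ * Real.log (τ - θ))
        - inner ℝ (θ' - θ) (κ / (τ - θ))))
      = (τ - θ) * Real.Gamma (a * κ) * Real.exp (a * κ - a * κ * Real.log (a * κ)) := by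
  have hs : 0 < τ - θ := sub_pos.2 hθ
  have haκ : 0 < a * κ := mul_pos ha hκ
  set s := τ - θ with hs_def
  have h1 : ∀ θ' ∈ Set.Iio τ, Real.exp (-a * ((C - κ * Real.log (τ - θ'))
      - (C - κ * Real.log s) - inner ℝ (θ' - θ) (κ / s)))
      = (fun u => Real.exp (a * κ - a * κ * Real.log s)
          * (u ^ (a * κ + 1 - 1) * Real.exp (-(a * κ / s * u)))) (τ - θ') := by
    intro θ' hθ'
    have hu : 0 < τ - θ' := sub_pos.2 hθ'
    simp only [Real.rpow_def_of_pos hu, ← Real.exp_add, RCLike.inner_apply, conj_trivial]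
    congr 1
    have : θ' - θ = s - (τ - θ') := by rw [hs_def]; ring
    rw [this]
    field_simp
    ring
  rw [setIntegral_congr_fun measurableSet_Iio h1,
    setIntegral_Iio_comp_sub_left (fun u => Real.exp (a * κ - a * κ * Real.log s)
      * (u ^ (a * κ + 1 - 1) * Real.exp (-(a * κ / s * u)))),
    integral_const_mul, Real.integral_rpow_mul_exp_neg_mul_Ioi (by positivity) (by positivity),
    Real.Gamma_add_one haκ.ne', Real.rpow_def_of_pos (by positivity), one_div, Real.log_inv,
    Real.log_div haκ.ne' hs.ne']
  have e1 : -(Real.log (a * κ) - Real.log s) * (a * κ + 1)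
      = -(a * κ * Real.log (a * κ)) + a * κ * Real.log s - Real.log (a * κ) + Real.log s := by ring
  rw [e1, Real.exp_add _ (Real.log s), Real.exp_log hs, Real.exp_sub _ (Real.log (a * κ)),
    Real.exp_log haκ, Real.exp_add, Real.exp_sub, Real.exp_sub, Real.exp_neg]
  field_simp

lemma IsExplicitFamily.of_log {𝒳 : Type*} [MeasurableSpace 𝒳] {ρ : Measure 𝒳} {F : 𝒳 → ℝ}
    {κ τ C : ℝ} (hκ : 0 < κ)
    (hint : ∀ θ < τ, ∫ x, Real.exp (θ * F x) ∂ρ = Real.exp (C - κ * Real.log (τ - θ)))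
    (hnot : ∀ θ, τ ≤ θ → ¬ Integrable (fun x => Real.exp (θ * F x)) ρ) :
    IsExplicitFamily ρ F (Set.Iio τ) (fun θ => C - κ * Real.log (τ - θ))
      (fun θ => κ / (τ - θ)) where
  isOpen := isOpen_Iio
  integral_eq θ hθ := by simpa [mul_comm] using hint θ hθ
  not_integrable θ hθ := by simpa [mul_comm] using hnot θ (not_lt.1 hθ)
  hasGradientAt θ hθ := by
    have hs : τ - θ ≠ 0 := (sub_pos.2 hθ).ne'
    have h : HasDerivAt (fun θ => C - κ * Real.log (τ - θ)) (-(κ * (-1 / (τ - θ)))) θ :=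
      ((((hasDerivAt_id θ).const_sub τ).log hs).const_mul κ).const_sub C
    convert h.hasGradientAt' using 1
    ring
  injOn := by
    intro θ hθ θ' hθ' h
    have hs : τ - θ ≠ 0 := (sub_pos.2 hθ).ne'
    have hs' : τ - θ' ≠ 0 := (sub_pos.2 hθ').ne'
    simp only at h
    rw [div_eq_div_iff hs hs'] at h
    have := mul_left_cancel₀ hκ.ne' h
    linarith

/-- The confidence set of a family with log-partition function `C - κ log (τ - θ)`, at the
parameter `τ - s`. The exponential, Gamma, Weibull and Pareto distributions and the Gaussian
distribution with known mean are of this form. -/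
theorem ExplicitSet.of_log {𝒳 Ω : Type*} [MeasurableSpace 𝒳] [MeasurableSpace Ω] {P : Measure Ω}
    [IsProbabilityMeasure P] {ρ : Measure 𝒳} [SFinite ρ] {F : 𝒳 → ℝ} {κ τ C s θ : ℝ} (hκ : 0 < κ)
    (hint : ∀ θ < τ, ∫ x, Real.exp (θ * F x) ∂ρ = Real.exp (C - κ * Real.log (τ - θ)))
    (hnot : ∀ θ, τ ≤ θ → ¬ Integrable (fun x => Real.exp (θ * F x)) ρ)
    (hF : Measurable F) {c δ : ℝ} (hc : 0 < c) (hδ : 0 < δ) {D : Measure 𝒳} (hs : 0 < s)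
    (hθ : θ = τ - s)
    (hD : D = ρ.withDensity fun x =>
      ENNReal.ofReal (Real.exp (θ * F x - (C - κ * Real.log s))))
    {supp : Set 𝒳} (hsupp : ∀ᵐ y ∂D, y ∈ supp) (hpos : ∀ y ∈ supp, 0 ≤ F y)
    {gain : ℕ → (ℕ → 𝒳) → ℝ} {ineq : ℕ → (ℕ → 𝒳) → Prop}
    (hgain : ∀ (n : ℕ) (x : ℕ → 𝒳), 0 ≤ s * ∑ t ∈ Finset.range n, F (x t) →
      Real.log (s * ∑ t ∈ Finset.range n, F (x t) + c * κ) - Real.log ((n + c) * κ)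
        + (Real.log (Real.Gamma (c * κ)) + c * κ - c * κ * Real.log (c * κ))
        - (Real.log (Real.Gamma ((n + c) * κ)) + (n + c) * κ
            - (n + c) * κ * Real.log ((n + c) * κ)) = gain n x)
    (hineq : ∀ (n : ℕ) (x : ℕ → 𝒳), 0 ≤ s * ∑ t ∈ Finset.range n, F (x t) →
      (s * ∑ t ∈ Finset.range n, F (x t) + c * κ - (n + c) * κ
        - (n + c) * κ * (Real.log (s * ∑ t ∈ Finset.range n, F (x t) + c * κ)
            - Real.log ((n + c) * κ)) ≤ Real.log (1 / δ) + gain n x ↔ ineq n x)) :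
    ExplicitSet P ρ F (Set.Iio τ) (volume.restrict (Set.Iio τ)) c δ D θ supp gain ineq := by
  have hsτ : τ - θ = s := by rw [hθ]; ring
  have hsum : ∀ (n : ℕ) (x : ℕ → 𝒳), (∀ t < n, x t ∈ supp) →
      0 ≤ s * ∑ t ∈ Finset.range n, F (x t) := fun n x hx =>
    mul_nonneg hs.le (Finset.sum_nonneg fun t ht => hpos _ (hx t (Finset.mem_range.1 ht)))
  have hnc : ∀ n : ℕ, 0 < (n : ℝ) + c := fun n => by positivity
  refine ExplicitSet.of_isExplicitFamily (IsExplicitFamily.of_log hκ hint hnot) hF subset_rfl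
    (ae_restrict_mem measurableSet_Iio) hc hδ (by rw [hθ]; simpa using hs) ?_ hsupp
    -- `κ / (τ - θ_n)` is the regularized mean feature
    (fun n x => τ - s * ((n + c) * κ) / (s * ∑ t ∈ Finset.range n, F (x t) + c * κ))
    (fun a θ => (τ - θ) * Real.Gamma (a * κ) * Real.exp (a * κ - a * κ * Real.log (a * κ)))
    ?_ ?_ ?_ ?_
  · rw [hD]
    simp [mul_comm, hsτ]
  · intro n x hx
    have h0 := hsum n x hx
    have hn := hnc n
    refine ⟨?_, ?_⟩
    · simp only [Set.mem_Iio, sub_lt_self_iff]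
      positivity
    · simp only [sub_sub_cancel, hsτ, smul_eq_mul]
      have : 0 < s * ∑ t ∈ Finset.range n, F (x t) + c * κ := by positivity
      field_simp
  · intro a ha θ' hθ'
    have : 0 < τ - θ' := sub_pos.2 hθ'
    have h2 : 0 < Real.Gamma (a * κ) := Real.Gamma_pos_of_pos (by positivity)
    exact ⟨by positivity, integral_exp_bregman_log C hκ ha hθ'⟩
  · intro n x hx
    rw [← hgain n x (hsum n x hx)]
    have h0 := hsum n x hx
    have hn := hnc n
    have h1 : 0 < s * ∑ t ∈ Finset.range n, F (x t) + c * κ := by positivity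
    have h2 : 0 < Real.Gamma (c * κ) := Real.Gamma_pos_of_pos (by positivity)
    have h3 : 0 < Real.Gamma ((n + c) * κ) := Real.Gamma_pos_of_pos (by positivity)
    have h4 : 0 < (n + c) * κ := by positivity
    simp only [sub_sub_cancel, hsτ]
    generalize (n + c) * κ = N at *
    generalize c * κ = M at *
    generalize s * ∑ t ∈ Finset.range n, F (x t) + M = S at *
    rw [Real.log_div (by positivity) (by positivity), Real.log_mul (by positivity) (by positivity),
      Real.log_mul (by positivity) (by positivity), Real.log_exp,
      Real.log_mul (by positivity) (by positivity), Real.log_mul (by positivity) (by positivity),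
      Real.log_exp, Real.log_div (by positivity) (by positivity),
      Real.log_mul (by positivity) (by positivity)]
    ring
  · intro n x hx
    rw [← hineq n x (hsum n x hx)]
    have h0 := hsum n x hx
    have hn := hnc n
    have h1 : 0 < s * ∑ t ∈ Finset.range n, F (x t) + c * κ := by positivity
    have e : ((n : ℝ) + c) * (C - κ * Real.log (τ - θ) - (C - κ * Real.log
        (τ - (τ - s * ((n + c) * κ) / (s * ∑ t ∈ Finset.range n, F (x t) + c * κ))))
        - inner ℝ (θ - (τ - s * ((n + c) * κ) / (s * ∑ t ∈ Finset.range n, F (x t) + c * κ)))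
        (κ / (τ - (τ - s * ((n + c) * κ) / (s * ∑ t ∈ Finset.range n, F (x t) + c * κ)))))
        = s * ∑ t ∈ Finset.range n, F (x t) + c * κ - (n + c) * κ
        - (n + c) * κ * (Real.log (s * ∑ t ∈ Finset.range n, F (x t) + c * κ)
            - Real.log ((n + c) * κ)) := by
      rw [sub_sub_cancel, hsτ, Real.log_div (by positivity) (by positivity),
        Real.log_mul (by positivity) (by positivity)]
      have : θ - (τ - s * ((n + c) * κ) / (s * ∑ t ∈ Finset.range n, F (x t) + c * κ))
        = s * ((n + c) * κ) / (s * ∑ t ∈ Finset.range n, F (x t) + c * κ) - s := by rw [hθ]; ring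
      rw [this]
      simp only [RCLike.inner_apply, conj_trivial]
      field_simp
      ring
    simp only [e]

/-! ### Measures with a density on a subset of the line -/

section Density

variable {s : Set ℝ} {h f : ℝ → ℝ}

lemma integral_restrict_withDensity_ofReal (hs : MeasurableSet s) (hm : Measurable h)
    (h0 : ∀ x ∈ s, 0 ≤ h x) :
    ∫ x, f x ∂((volume.restrict s).withDensity fun x => ENNReal.ofReal (h x))
      = ∫ x in s, h x * f x := by
  rw [integral_withDensity_eq_integral_toReal_smul hm.ennreal_ofReal (by simp)]
  refine setIntegral_congr_fun hs fun x hx => ?_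
  simp [ENNReal.toReal_ofReal (h0 x hx)]

lemma integrable_restrict_withDensity_ofReal_iff (hs : MeasurableSet s) (hm : Measurable h)
    (h0 : ∀ x ∈ s, 0 ≤ h x) :
    Integrable f ((volume.restrict s).withDensity fun x => ENNReal.ofReal (h x))
      ↔ IntegrableOn (fun x => h x * f x) s := by
  rw [integrable_withDensity_iff_integrable_smul' hm.ennreal_ofReal (by simp)]
  refine integrableOn_congr_fun (fun x hx => ?_) hs
  simp [ENNReal.toReal_ofReal (h0 x hx)]

lemma withDensity_ofReal_withDensity_ofReal {μ : Measure ℝ} {e : ℝ → ℝ} (hm : Measurable h)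
    (hem : Measurable e) (he : ∀ x, 0 ≤ e x) :
    (μ.withDensity fun x => ENNReal.ofReal (h x)).withDensity (fun x => ENNReal.ofReal (e x))
      = μ.withDensity fun x => ENNReal.ofReal (h x * e x) := by
  rw [← withDensity_mul _ hm.ennreal_ofReal hem.ennreal_ofReal]
  congr 1
  funext x
  simp [ENNReal.ofReal_mul' (he x)]

lemma withDensity_ofReal_eq_restrict (hs : MeasurableSet s) {d : ℝ → ℝ}
    (h1 : ∀ x ∈ s, d x = f x) (h2 : ∀ x ∉ s, d x ≤ 0) :
    (volume : Measure ℝ).withDensity (fun x => ENNReal.ofReal (d x))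
      = (volume.restrict s).withDensity fun x => ENNReal.ofReal (f x) := by
  rw [← withDensity_indicator hs]
  congr 1
  funext x
  by_cases hx : x ∈ s
  · simp [hx, h1 x hx]
  · simp [hx, h2 x hx]

end Density

lemma integral_Ioi_rpow_mul_exp {k θ : ℝ} (hk : 0 < k) (hθ : θ < 0) :
    ∫ x in Set.Ioi (0 : ℝ), x ^ (k - 1) * Real.exp (θ * x)
      = Real.Gamma k * Real.exp (-(k * Real.log (-θ))) := by
  have h := Real.integral_rpow_mul_exp_neg_mul_Ioi hk (neg_pos.2 hθ)
  simp only [neg_mul, neg_neg] at h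
  rw [h, Real.rpow_def_of_pos (by simpa using hθ), one_div, Real.log_inv]
  ring_nf

lemma not_integrableOn_rpow_mul_exp (k : ℝ) {θ : ℝ} (hθ : 0 ≤ θ) :
    ¬ IntegrableOn (fun x : ℝ => x ^ (k - 1) * Real.exp (θ * x)) (Set.Ioi 0) := by
  intro h
  refine not_integrableOn_Ioi_rpow (k - 1) (Integrable.mono' h (by fun_prop) ?_)
  filter_upwards [ae_restrict_mem measurableSet_Ioi] with x hx
  have hx' : (0 : ℝ) < x := hx
  rw [Real.norm_of_nonneg (by positivity)]
  exact le_mul_of_one_le_right (by positivity) (Real.one_le_exp (by positivity))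

/-! ### Gaussian with known mean, exponential, Gamma, Weibull and Pareto distributions -/

section Families

variable {Ω : Type*} [MeasurableSpace Ω] (P : Measure Ω) [IsProbabilityMeasure P] {c δ : ℝ}

theorem explicitSet_gaussian_variance (hc : 0 < c) (hδ : 0 < δ) (μ σ : ℝ) (hσ : 0 < σ) :
    ExplicitSet P
      (ENNReal.ofReal (1 / √(2 * Real.pi)) • (volume : Measure ℝ)) (fun x : ℝ => (x - μ) ^ 2)
      (Set.Iio (0 : ℝ)) (volume.restrict (Set.Iio 0)) c δ
      (gaussianReal μ (Real.toNNReal (σ ^ 2))) (-1 / (2 * σ ^ 2)) Set.univ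
      (fun n x => Real.log ((Q μ n x / σ ^ 2 + c) / (n + c))
        - (1 + Real.log 2) * (n / 2) - (c / 2 + 1) * Real.log c
        + ((n + c) / 2 + 1) * Real.log (n + c)
        + Real.log (Real.Gamma (c / 2 + 1) / Real.Gamma ((n + c) / 2 + 1)))
      (fun n x => Q μ n x / (2 * σ ^ 2)
          - ((n + c) / 2 + 1) * Real.log (Q μ n x / σ ^ 2 + c) ≤
        Real.log (1 / δ) + Real.log (Real.Gamma (c / 2 + 1) / Real.Gamma ((n + c) / 2 + 1))
          - n / 2 * Real.log 2 - (c / 2 + 1) * Real.log c) := by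
  have hlogQ : ∀ (n : ℕ) (x : ℕ → ℝ),
      0 ≤ 1 / (2 * σ ^ 2) * ∑ t ∈ Finset.range n, (x t - μ) ^ 2 →
      Real.log (1 / (2 * σ ^ 2) * ∑ t ∈ Finset.range n, (x t - μ) ^ 2 + c * (1 / 2))
        = Real.log (Q μ n x / σ ^ 2 + c) - Real.log 2 := by
    intro n x h0
    have e : 1 / (2 * σ ^ 2) * ∑ t ∈ Finset.range n, (x t - μ) ^ 2 + c * (1 / 2)
        = (Q μ n x / σ ^ 2 + c) / 2 := by
      rw [Q]; field_simp
    have : 0 < Q μ n x / σ ^ 2 + c := by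
      have : 0 < (Q μ n x / σ ^ 2 + c) / 2 := by rw [← e]; positivity
      linarith
    rw [e, Real.log_div this.ne' two_ne_zero]
  have hlogΓ : ∀ a : ℝ, 0 < a → Real.log (Real.Gamma (a * (1 / 2)))
      = Real.log (Real.Gamma (a / 2 + 1)) - Real.log a + Real.log 2 := by
    intro a ha
    rw [Real.Gamma_add_one (by positivity), Real.log_mul (by positivity)
      (Real.Gamma_pos_of_pos (by positivity)).ne', Real.log_div (by positivity) (by positivity)]
    ring_nf
  have hgain : ∀ (n : ℕ) (x : ℕ → ℝ),
      0 ≤ 1 / (2 * σ ^ 2) * ∑ t ∈ Finset.range n, (x t - μ) ^ 2 →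
      Real.log ((Q μ n x / σ ^ 2 + c) / (n + c))
        - (1 + Real.log 2) * (n / 2) - (c / 2 + 1) * Real.log c
        + ((n + c) / 2 + 1) * Real.log (n + c)
        + Real.log (Real.Gamma (c / 2 + 1) / Real.Gamma ((n + c) / 2 + 1)) =
      Real.log (Q μ n x / σ ^ 2 + c) - Real.log (n + c)
        - (1 + Real.log 2) * (n / 2) - (c / 2 + 1) * Real.log c
        + ((n + c) / 2 + 1) * Real.log (n + c)
        + (Real.log (Real.Gamma (c / 2 + 1)) - Real.log (Real.Gamma ((n + c) / 2 + 1))) := by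
    intro n x h0
    have hq : 0 ≤ Q μ n x := Finset.sum_nonneg fun _ _ => sq_nonneg _
    rw [Real.log_div (by positivity) (by positivity),
      Real.log_div (Real.Gamma_pos_of_pos (by positivity)).ne'
        (Real.Gamma_pos_of_pos (by positivity)).ne']
  have hlog2 : ∀ a : ℝ, 0 < a → Real.log (a * (1 / 2)) = Real.log a - Real.log 2 := by
    intro a ha
    rw [mul_one_div, Real.log_div ha.ne' two_ne_zero]
  refine ExplicitSet.of_log (κ := 1 / 2) (τ := 0) (C := -(1 / 2 * Real.log 2))
    (s := 1 / (2 * σ ^ 2)) (by norm_num) ?_ ?_ (by fun_prop) hc hδ (by positivity) (by ring) ?_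
    (by simp) (fun y _ => sq_nonneg _) ?_ ?_
  · intro θ hθ
    rw [integral_smul_measure, integral_sub_right_eq_self (fun x => Real.exp (θ * x ^ 2)) μ]
    have h := integral_gaussian (-θ)
    rw [neg_neg] at h
    have hθ' : 0 < -θ := neg_pos.2 hθ
    have e : Real.exp (-(1 / 2 * Real.log 2) - 1 / 2 * Real.log (-θ)) = 1 / √(2 * -θ) := by
      rw [Real.sqrt_eq_rpow, Real.rpow_def_of_pos (by positivity), one_div (Real.exp _),
        ← Real.exp_neg, Real.log_mul two_ne_zero hθ'.ne']
      ring_nf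
    rw [h, ENNReal.toReal_ofReal (by positivity), zero_sub, e, smul_eq_mul,
      Real.sqrt_div Real.pi_nonneg, Real.sqrt_mul zero_le_two, Real.sqrt_mul zero_le_two]
    field_simp
  · intro θ hθ hi
    rw [integrable_smul_measure (by simp; positivity) ENNReal.ofReal_ne_top] at hi
    have h2 := (integrable_exp_neg_mul_sq_iff (b := -θ)).1
      (by simpa using hi.comp_add_right μ)
    linarith
  · have hσ2 : Real.toNNReal (σ ^ 2) ≠ 0 := by simpa using hσ.ne'
    rw [gaussianReal_of_var_ne_zero μ hσ2, withDensity_smul_measure,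
      ← withDensity_smul _ (by fun_prop)]
    congr 1
    funext x
    simp only [gaussianPDF, gaussianPDFReal, Pi.smul_apply, smul_eq_mul]
    rw [← ENNReal.ofReal_mul (by positivity)]
    congr 1
    have e : Real.exp (-1 / (2 * σ ^ 2) * (x - μ) ^ 2
        - (-(1 / 2 * Real.log 2) - 1 / 2 * Real.log (1 / (2 * σ ^ 2))))
        = Real.exp (-(x - μ) ^ 2 / (2 * σ ^ 2)) / σ := by
      rw [one_div (2 * σ ^ 2), Real.log_inv, Real.log_mul two_ne_zero (by positivity), Real.log_pow]
      nth_rw 4 [← Real.exp_log hσ]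
      rw [← Real.exp_sub]
      congr 1
      push_cast
      ring
    rw [Real.coe_toNNReal _ (by positivity), Real.sqrt_mul (by positivity) (σ ^ 2),
      Real.sqrt_sq hσ.le, e]
    field_simp
  · intro n x h0
    have hn : 0 < (n : ℝ) + c := by positivity
    rw [hlogQ n x h0, hgain n x h0, hlogΓ c hc, hlogΓ _ hn, hlog2 c hc, hlog2 _ hn]
    ring
  · intro n x h0
    have hn : 0 < (n : ℝ) + c := by positivity
    rw [hlogQ n x h0, hgain n x h0, hlog2 _ hn,
      Real.log_div (Real.Gamma_pos_of_pos (by positivity)).ne'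
        (Real.Gamma_pos_of_pos (by positivity)).ne']
    have e : Q μ n x / (2 * σ ^ 2) = 1 / (2 * σ ^ 2) * ∑ t ∈ Finset.range n, (x t - μ) ^ 2 := by
      rw [Q]; ring
    rw [e]
    constructor <;> intro h <;> linarith

lemma log_Gamma_mul_exp_div_rpow {a : ℝ} (ha : 0 < a) :
    Real.log (Real.Gamma a * (Real.exp 1 / a) ^ a)
      = Real.log (Real.Gamma a) + a - a * Real.log a := by
  rw [Real.log_mul (Real.Gamma_pos_of_pos ha).ne' (by positivity), Real.log_rpow (by positivity),
    Real.log_div (by positivity) ha.ne', Real.log_exp]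
  ring

lemma log_Gamma_div_Gamma {a b : ℝ} (ha : 0 < a) (hb : 0 < b) :
    Real.log (Real.Gamma a / Real.Gamma b)
      = Real.log (Real.Gamma a) - Real.log (Real.Gamma b) :=
  Real.log_div (Real.Gamma_pos_of_pos ha).ne' (Real.Gamma_pos_of_pos hb).ne'

theorem explicitSet_exponential (hc : 0 < c) (hδ : 0 < δ) (μ : ℝ) (hμ : 0 < μ) :
    ExplicitSet P
      (volume.restrict (Set.Ici (0 : ℝ))) (fun x : ℝ => x)
      (Set.Iio (0 : ℝ)) (volume.restrict (Set.Iio 0)) c δ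
      (expMeasure (1 / μ)) (-1 / μ) (Set.Ici 0)
      (fun n x => Real.log (S n x / μ + c)
        + Real.log (Real.Gamma c / Real.Gamma (n + c))
        + (n + c - 1) * Real.log (n + c) - c * Real.log c - n)
      (fun n x => S n x / μ
          - (n + c + 1) * Real.log (S n x / μ + c) ≤
        Real.log (1 / δ) + Real.log (Real.Gamma c / Real.Gamma (n + c))
          - Real.log (n + c) - c * Real.log c) := by
  have hS : ∀ (n : ℕ) (x : ℕ → ℝ), 1 / μ * ∑ t ∈ Finset.range n, x t = S n x / μ :=
    fun n x => one_div_mul_eq_div _ _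
  have hD : expMeasure (1 / μ) = (volume.restrict (Set.Ici (0 : ℝ))).withDensity fun x =>
      ENNReal.ofReal (Real.exp (-1 / μ * x - (0 - 1 * Real.log (1 / μ)))) := by
    refine withDensity_ofReal_eq_restrict measurableSet_Ici ?_ ?_
    · intro x hx
      rw [zero_sub, sub_neg_eq_add, one_mul, Real.exp_add, Real.exp_log (by positivity),
        gammaPDFReal, if_pos (Set.mem_Ici.1 hx)]
      simp
      ring_nf
    · intro x hx
      rw [gammaPDFReal, if_neg (mt Set.mem_Ici.2 hx)]
  refine ExplicitSet.of_log (κ := 1) (τ := 0) (C := 0) (s := 1 / μ) one_pos ?_ ?_ (by fun_prop)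
    hc hδ (by positivity) (by ring) hD ?_ (fun y hy => hy) ?_ ?_
  · intro θ hθ
    have h := integral_Ioi_rpow_mul_exp one_pos hθ
    simpa [integral_Ici_eq_integral_Ioi] using h
  · intro θ hθ hi
    refine not_integrableOn_rpow_mul_exp 1 hθ ?_
    have h : IntegrableOn (fun x : ℝ => Real.exp (θ * x)) (Set.Ioi 0) :=
      hi.mono_measure (Measure.restrict_mono Set.Ioi_subset_Ici_self le_rfl)
    simpa using h
  · rw [hD]
    exact (withDensity_absolutelyContinuous _ _).ae_le (ae_restrict_mem measurableSet_Ici)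
  · intro n x h0
    rw [hS, mul_one, mul_one, log_Gamma_div_Gamma hc (by positivity)]
    ring
  · intro n x h0
    rw [hS, mul_one, mul_one, log_Gamma_div_Gamma hc (by positivity)]
    constructor <;> intro h <;> linarith

theorem explicitSet_gamma (hc : 0 < c) (hδ : 0 < δ) (k l : ℝ) (hk : 0 < k) (hl : 0 < l) :
    ExplicitSet P
      ((volume.restrict (Set.Ici (0 : ℝ))).withDensity
        fun x => ENNReal.ofReal (x ^ (k - 1) / Real.Gamma k)) (fun x : ℝ => x)
      (Set.Iio (0 : ℝ)) (volume.restrict (Set.Iio 0)) c δ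
      (gammaMeasure k (1 / l)) (-1 / l) (Set.Ici 0)
      (fun n x => Real.log ((S n x + c * k * l) / ((n + c) * k * l))
        + Real.log (Real.Gamma (c * k) * (Real.exp 1 / (c * k)) ^ (c * k))
        - Real.log (Real.Gamma ((n + c) * k)
            * (Real.exp 1 / ((n + c) * k)) ^ ((n + c) * k)))
      (fun n x => S n x / l
          - ((n + c) * k + 1) * Real.log (S n x / l + c * k) ≤
        Real.log (1 / δ) + Real.log (Real.Gamma (c * k) / Real.Gamma ((n + c) * k))
          - Real.log ((n + c) * k) - c * k * Real.log (c * k)) := by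
  have hΓ : 0 < Real.Gamma k := Real.Gamma_pos_of_pos hk
  have hm : Measurable fun x : ℝ => x ^ (k - 1) / Real.Gamma k := by fun_prop
  have h0 : ∀ x ∈ Set.Ici (0 : ℝ), 0 ≤ x ^ (k - 1) / Real.Gamma k := fun x hx =>
    div_nonneg (Real.rpow_nonneg hx _) hΓ.le
  have hS : ∀ (n : ℕ) (x : ℕ → ℝ), 1 / l * ∑ t ∈ Finset.range n, x t = S n x / l :=
    fun n x => one_div_mul_eq_div _ _
  have hlog : ∀ (n : ℕ) (x : ℕ → ℝ), 0 ≤ S n x / l →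
      Real.log ((S n x + c * k * l) / ((n + c) * k * l))
        = Real.log (S n x / l + c * k) - Real.log ((n + c) * k) := by
    intro n x h
    rw [← Real.log_div (by positivity) (by positivity)]
    congr 1
    field_simp
  have hD : gammaMeasure k (1 / l) = ((volume.restrict (Set.Ici (0 : ℝ))).withDensity
      fun x => ENNReal.ofReal (x ^ (k - 1) / Real.Gamma k)).withDensity fun x =>
      ENNReal.ofReal (Real.exp (-1 / l * x - (0 - k * Real.log (1 / l)))) := by
    rw [withDensity_ofReal_withDensity_ofReal hm (by fun_prop) fun _ => Real.exp_nonneg _]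
    refine withDensity_ofReal_eq_restrict measurableSet_Ici ?_ ?_
    · intro x hx
      rw [zero_sub, sub_neg_eq_add, Real.exp_add, gammaPDFReal, if_pos (Set.mem_Ici.1 hx),
        Real.rpow_def_of_pos (by positivity : 0 < 1 / l)]
      ring_nf
    · intro x hx
      rw [gammaPDFReal, if_neg (mt Set.mem_Ici.2 hx)]
  refine ExplicitSet.of_log (κ := k) (τ := 0) (C := 0) (s := 1 / l) hk ?_ ?_ (by fun_prop)
    hc hδ (by positivity) (by ring) hD ?_ (fun y hy => hy) ?_ ?_
  · intro θ hθ
    rw [integral_restrict_withDensity_ofReal measurableSet_Ici hm h0, integral_Ici_eq_integral_Ioi]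
    have h := integral_Ioi_rpow_mul_exp hk hθ
    simp only [div_mul_eq_mul_div, integral_div, h, zero_sub]
    field_simp
  · intro θ hθ hi
    rw [integrable_restrict_withDensity_ofReal_iff measurableSet_Ici hm h0] at hi
    refine not_integrableOn_rpow_mul_exp k hθ ?_
    have := (hi.mono_set Set.Ioi_subset_Ici_self).mul_const (Real.Gamma k)
    refine this.congr (ae_of_all _ fun x => ?_)
    simp only
    field_simp
  · rw [hD]
    exact (withDensity_absolutelyContinuous _ _).ae_le
      ((withDensity_absolutelyContinuous _ _).ae_le (ae_restrict_mem measurableSet_Ici))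
  · intro n x h0
    rw [hS] at h0 ⊢
    rw [hlog n x h0, log_Gamma_mul_exp_div_rpow (by positivity),
      log_Gamma_mul_exp_div_rpow (by positivity)]
  · intro n x h0
    rw [hS] at h0 ⊢
    rw [hlog n x h0, log_Gamma_mul_exp_div_rpow (by positivity),
      log_Gamma_mul_exp_div_rpow (by positivity), log_Gamma_div_Gamma (by positivity)
        (by positivity)]
    constructor <;> intro h <;> linarith

theorem explicitSet_weibull (hc : 0 < c) (hδ : 0 < δ) (k l : ℝ) (hk : 0 < k) (hl : 0 < l) :
    ExplicitSet P
      ((volume.restrict (Set.Ici (0 : ℝ))).withDensity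
        fun x => ENNReal.ofReal (k * x ^ (k - 1))) (fun x : ℝ => x ^ k)
      (Set.Iio (0 : ℝ)) (volume.restrict (Set.Iio 0)) c δ
      (weibullMeasure l k) (-1 / l ^ k) (Set.Ici 0)
      (fun n x => Real.log ((Spow k n x + c * l ^ k) / ((n + c) * l ^ k))
        + Real.log (Real.Gamma c * (Real.exp 1 / c) ^ c)
        - Real.log (Real.Gamma (n + c) * (Real.exp 1 / (n + c)) ^ (n + c)))
      (fun n x => Spow k n x / l ^ k
          - (n + c + 1) * Real.log (Spow k n x / l ^ k + c) ≤
        Real.log (1 / δ) + Real.log (Real.Gamma c / Real.Gamma (n + c))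
          - Real.log (n + c) - c * Real.log c) := by
  have hlk : 0 < l ^ k := Real.rpow_pos_of_pos hl k
  have hm : Measurable fun x : ℝ => k * x ^ (k - 1) := by fun_prop
  have h0 : ∀ x ∈ Set.Ici (0 : ℝ), 0 ≤ k * x ^ (k - 1) := fun x hx =>
    mul_nonneg hk.le (Real.rpow_nonneg hx _)
  have hS : ∀ (n : ℕ) (x : ℕ → ℝ), 1 / l ^ k * ∑ t ∈ Finset.range n, x t ^ k
      = Spow k n x / l ^ k := fun n x => one_div_mul_eq_div _ _
  have hlog : ∀ (n : ℕ) (x : ℕ → ℝ), 0 ≤ Spow k n x / l ^ k →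
      Real.log ((Spow k n x + c * l ^ k) / ((n + c) * l ^ k))
        = Real.log (Spow k n x / l ^ k + c) - Real.log (n + c) := by
    intro n x h
    rw [← Real.log_div (by positivity) (by positivity)]
    congr 1
    field_simp
  have hD : weibullMeasure l k = ((volume.restrict (Set.Ici (0 : ℝ))).withDensity
      fun x => ENNReal.ofReal (k * x ^ (k - 1))).withDensity fun x =>
      ENNReal.ofReal (Real.exp (-1 / l ^ k * x ^ k - (0 - 1 * Real.log (1 / l ^ k)))) := by
    rw [withDensity_ofReal_withDensity_ofReal hm (by fun_prop) fun _ => Real.exp_nonneg _]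
    refine withDensity_ofReal_eq_restrict measurableSet_Ici ?_ ?_
    · intro x hx
      rw [zero_sub, sub_neg_eq_add, one_mul, Real.exp_add, Real.exp_log (by positivity),
        if_pos (Set.mem_Ici.1 hx), Real.div_rpow hx hl.le, Real.div_rpow hx hl.le,
        Real.rpow_sub_one hl.ne']
      field_simp
    · intro x hx
      rw [if_neg (mt Set.mem_Ici.2 hx)]
  refine ExplicitSet.of_log (κ := 1) (τ := 0) (C := 0) (s := 1 / l ^ k) one_pos ?_ ?_
    (by fun_prop) hc hδ (by positivity) (by ring) hD ?_ (fun y hy => Real.rpow_nonneg hy _) ?_ ?_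
  · intro θ hθ
    rw [integral_restrict_withDensity_ofReal measurableSet_Ici hm h0, integral_Ici_eq_integral_Ioi]
    have h := integral_comp_rpow_Ioi_of_pos (g := fun y => Real.exp (θ * y)) hk
    have h' := integral_Ioi_rpow_mul_exp one_pos hθ
    simp only [smul_eq_mul] at h
    rw [h]
    simpa using h'
  · intro θ hθ hi
    rw [integrable_restrict_withDensity_ofReal_iff measurableSet_Ici hm h0] at hi
    refine not_integrableOn_rpow_mul_exp 1 hθ ?_
    have h := (integrableOn_Ioi_comp_rpow_iff (fun y => Real.exp (θ * y)) hk.ne').1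
      (by simpa [abs_of_pos hk] using hi.mono_set Set.Ioi_subset_Ici_self)
    simpa using h
  · rw [hD]
    exact (withDensity_absolutelyContinuous _ _).ae_le
      ((withDensity_absolutelyContinuous _ _).ae_le (ae_restrict_mem measurableSet_Ici))
  · intro n x h0
    rw [hS] at h0 ⊢
    simp only [mul_one]
    rw [hlog n x h0, log_Gamma_mul_exp_div_rpow (by positivity),
      log_Gamma_mul_exp_div_rpow (by positivity)]
  · intro n x h0
    rw [hS] at h0 ⊢
    simp only [mul_one]
    rw [hlog n x h0, log_Gamma_mul_exp_div_rpow (by positivity),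
      log_Gamma_mul_exp_div_rpow (by positivity), log_Gamma_div_Gamma (by positivity)
        (by positivity)]
    constructor <;> intro h <;> linarith

theorem explicitSet_pareto (hc : 0 < c) (hδ : 0 < δ) (α : ℝ) (hα : 0 < α) :
    ExplicitSet P
      (volume.restrict (Set.Ici (1 : ℝ))) (fun x : ℝ => Real.log x)
      (Set.Iio (-1 : ℝ)) (volume.restrict (Set.Iio (-1))) c δ
      (paretoMeasure 1 α) (-1 - α) (Set.Ici 1)
      (fun n x => Real.log (α * Llog n x + c)
        + Real.log (Real.Gamma c / Real.Gamma (n + c))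
        + (n + c - 1) * Real.log (n + c) - c * Real.log c - n)
      (fun n x => α * Llog n x
          - (n + c + 1) * Real.log (α * Llog n x + c) ≤
        Real.log (1 / δ) + Real.log (Real.Gamma c / Real.Gamma (n + c))
          - Real.log (n + c) - c * Real.log c) := by
  have hpow : ∀ θ : ℝ, ∀ x ∈ Set.Ici (1 : ℝ), Real.exp (θ * Real.log x) = x ^ θ := by
    intro θ x hx
    rw [Real.rpow_def_of_pos (zero_lt_one.trans_le hx), mul_comm]
  have hD : paretoMeasure 1 α = (volume.restrict (Set.Ici (1 : ℝ))).withDensity fun x =>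
      ENNReal.ofReal (Real.exp ((-1 - α) * Real.log x - (0 - 1 * Real.log α))) := by
    refine withDensity_ofReal_eq_restrict measurableSet_Ici ?_ ?_
    · intro x hx
      rw [zero_sub, sub_neg_eq_add, one_mul, Real.exp_add, Real.exp_log hα, paretoPDFReal,
        if_pos (Set.mem_Ici.1 hx), hpow _ x hx, Real.one_rpow]
      ring_nf
    · intro x hx
      rw [paretoPDFReal, if_neg (mt Set.mem_Ici.2 hx)]
  refine ExplicitSet.of_log (κ := 1) (τ := -1) (C := 0) (s := α) one_pos ?_ ?_
    (by fun_prop) hc hδ hα rfl hD ?_ (fun y hy => Real.log_nonneg hy) ?_ ?_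
  · intro θ hθ
    rw [setIntegral_congr_fun measurableSet_Ici (hpow θ), integral_Ici_eq_integral_Ioi,
      integral_Ioi_rpow_of_lt hθ one_pos, Real.one_rpow, zero_sub, one_mul, ← Real.log_inv,
      Real.exp_log (by rw [inv_pos]; linarith), ← neg_add', inv_neg, neg_div, one_div, add_comm]
  · intro θ hθ hi
    have h : IntegrableOn (fun x : ℝ => x ^ θ) (Set.Ioi 1) :=
      ((integrableOn_congr_fun (hpow θ) measurableSet_Ici).1 hi).mono_set Set.Ioi_subset_Ici_self
    exact absurd ((integrableOn_Ioi_rpow_iff one_pos).1 h) (not_lt.2 hθ)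
  · rw [hD]
    exact (withDensity_absolutelyContinuous _ _).ae_le (ae_restrict_mem measurableSet_Ici)
  · intro n x h0
    change Real.log (α * Llog n x + c * 1) - _ + _ - _ = _
    rw [mul_one, mul_one, log_Gamma_div_Gamma hc (by positivity)]
    ring
  · intro n x h0
    change α * Llog n x + c * 1 - _ - _ * (Real.log (α * Llog n x + c * 1) - _) ≤ _ ↔ _
    rw [mul_one, mul_one, log_Gamma_div_Gamma hc (by positivity)]
    constructor <;> intro h <;> linarith

end Families

/-! ### Gaussian with known variance -/

section Gaussian

theorem explicitSet_gaussian_mean {Ω : Type*} [MeasurableSpace Ω] (P : Measure Ω)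
    [IsProbabilityMeasure P] {c δ : ℝ} (hc : 0 < c) (hδ : 0 < δ) (μ σ : ℝ) (hσ : 0 < σ) :
    ExplicitSet P
      (gaussianReal 0 (Real.toNNReal (σ ^ 2))) (fun x : ℝ => x / σ ^ 2)
      (Set.univ : Set ℝ) volume c δ
      (gaussianReal μ (Real.toNNReal (σ ^ 2))) μ Set.univ
      (fun n _ => 1 / 2 * Real.log ((n + c) / c))
      (fun n x => 1 / (n + c) * ((S n x - n * μ) ^ 2 / (2 * σ ^ 2)) ≤
        Real.log (1 / δ) + 1 / 2 * Real.log ((n + c) / c)) := by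
  have hv : Real.toNNReal (σ ^ 2) ≠ 0 := by simpa using hσ.ne'
  have hcoe : ((Real.toNNReal (σ ^ 2) : NNReal) : ℝ) = σ ^ 2 := Real.coe_toNNReal _ (by positivity)
  have hfam : IsExplicitFamily (gaussianReal 0 (Real.toNNReal (σ ^ 2))) (fun x : ℝ => x / σ ^ 2)
      Set.univ (fun θ => θ ^ 2 / (2 * σ ^ 2)) (fun θ => θ / σ ^ 2) :=
    { isOpen := isOpen_univ
      integral_eq := by
        intro θ _
        have h := congrFun (mgf_id_gaussianReal (μ := 0) (v := Real.toNNReal (σ ^ 2))) (θ / σ ^ 2)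
        rw [mgf] at h
        simp only [id, hcoe] at h
        simp only [RCLike.inner_apply, conj_trivial]
        convert h using 2
        · funext x
          ring_nf
        · field_simp
          ring
      not_integrable := fun θ hθ => absurd (Set.mem_univ θ) hθ
      hasGradientAt := by
        intro θ _
        have h : HasDerivAt (fun θ : ℝ => θ ^ 2 / (2 * σ ^ 2)) (2 * θ / (2 * σ ^ 2)) θ := by
          simpa using (hasDerivAt_pow 2 θ).div_const (2 * σ ^ 2)
        convert h.hasGradientAt' using 1
        field_simp
      injOn := by
        intro θ _ θ' _ h
        simpa [div_left_inj' (pow_ne_zero 2 hσ.ne')] using h }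
  refine ExplicitSet.of_isExplicitFamily hfam (by fun_prop) subset_rfl (by simp) hc hδ
    (Set.mem_univ μ) ?_ (by simp) (fun n x => (S n x + c * μ) / (n + c))
    (fun a _ => √(Real.pi / (a / (2 * σ ^ 2)))) ?_ ?_ ?_ ?_
  · rw [gaussianReal_of_var_ne_zero μ hv, gaussianReal_of_var_ne_zero 0 hv]
    have h := withDensity_ofReal_withDensity_ofReal (μ := volume)
      (h := gaussianPDFReal 0 (Real.toNNReal (σ ^ 2)))
      (e := fun x => Real.exp (inner ℝ μ (x / σ ^ 2) - μ ^ 2 / (2 * σ ^ 2)))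
      (measurable_gaussianPDFReal _ _) (by fun_prop) (fun _ => Real.exp_nonneg _)
    refine Eq.trans ?_ h.symm
    congr 1
    funext x
    rw [gaussianPDF]
    congr 1
    simp only [gaussianPDFReal, hcoe, RCLike.inner_apply, conj_trivial]
    rw [mul_assoc (√(2 * Real.pi * σ ^ 2))⁻¹, ← Real.exp_add]
    congr 2
    field_simp
    ring
  · intro n x _
    have hn : 0 < (n : ℝ) + c := by positivity
    refine ⟨Set.mem_univ _, ?_⟩
    rw [← Finset.sum_div, smul_eq_mul, smul_eq_mul, S]
    field_simp
  · intro a ha θ _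
    refine ⟨by positivity, ?_⟩
    rw [← integral_gaussian, ← integral_sub_right_eq_self (μ := volume)
      (fun x : ℝ => Real.exp (-(a / (2 * σ ^ 2)) * x ^ 2)) θ]
    congr 1
    funext θ'
    congr 1
    simp only [RCLike.inner_apply, conj_trivial]
    field_simp
    ring
  · intro n x _
    have hn : 0 < (n : ℝ) + c := by positivity
    rw [← Real.sqrt_div (by positivity), Real.log_sqrt (by positivity), one_div_mul_eq_div]
    congr 2
    field_simp
  · intro n x _
    have hn : 0 < (n : ℝ) + c := by positivity
    have e : ((n : ℝ) + c) * (μ ^ 2 / (2 * σ ^ 2) - ((S n x + c * μ) / (n + c)) ^ 2 / (2 * σ ^ 2)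
        - inner ℝ (μ - (S n x + c * μ) / (n + c)) ((S n x + c * μ) / (n + c) / σ ^ 2))
        = 1 / (n + c) * ((S n x - n * μ) ^ 2 / (2 * σ ^ 2)) := by
      simp only [RCLike.inner_apply, conj_trivial]
      field_simp
      ring
    simp only [e]

end Gaussian

/-! ### Poisson distribution -/

section Poisson

/-- The substitution `u = exp θ` turns `I` into a Gamma integral. -/
lemma I_eq {a b : ℝ} (ha : 0 < a) (hb : 0 < b) : I a b = (1 / a) ^ b * Real.Gamma b := by
  rw [← Real.integral_rpow_mul_exp_neg_mul_Ioi hb ha, I, ← Real.range_exp, ← Set.image_univ,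
    integral_image_eq_integral_abs_deriv_smul MeasurableSet.univ
      (fun x _ => (Real.hasDerivAt_exp x).hasDerivWithinAt) Real.exp_injective.injOn,
    Measure.restrict_univ]
  congr 1
  funext θ
  rw [abs_of_pos (Real.exp_pos θ), smul_eq_mul, ← Real.exp_mul, ← Real.exp_add, ← Real.exp_add]
  congr 1
  ring

lemma I_pos {a b : ℝ} (ha : 0 < a) (hb : 0 < b) : 0 < I a b := by
  have := Real.Gamma_pos_of_pos hb
  rw [I_eq ha hb]
  positivity

lemma integral_exp_count_factorial (θ : ℝ) :
    ∫ k : ℕ, Real.exp (θ * k)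
      ∂(Measure.count.withDensity fun k : ℕ => ENNReal.ofReal (1 / (Nat.factorial k : ℝ)))
      = Real.exp (Real.exp θ) := by
  have h : ∀ k : ℕ, (ENNReal.ofReal (1 / (Nat.factorial k : ℝ))).toReal • Real.exp (θ * k)
      = Real.exp θ ^ k / (Nat.factorial k : ℝ) := by
    intro k
    rw [ENNReal.toReal_ofReal (by positivity), mul_comm θ, Real.exp_nat_mul, smul_eq_mul,
      one_div_mul_eq_div]
  rw [integral_withDensity_eq_integral_toReal_smul (measurable_of_countable _) (by simp)]
  simp only [h]
  have hs := Real.summable_pow_div_factorial (Real.exp θ)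
  rw [integral_countable (integrable_count_iff.2 hs.norm), Real.exp_eq_exp_ℝ,
    NormedSpace.exp_eq_tsum_div]
  simp [Measure.real]

theorem explicitSet_poisson {Ω : Type*} [MeasurableSpace Ω] (P : Measure Ω)
    [IsProbabilityMeasure P] {c δ : ℝ} (hc : 0 < c) (hδ : 0 < δ) (l : ℝ) (hl : 0 < l) :
    ExplicitSet P
      (Measure.count.withDensity fun k : ℕ => ENNReal.ofReal (1 / (Nat.factorial k : ℝ)))
      (fun k : ℕ => (k : ℝ))
      (Set.univ : Set ℝ) volume c δ
      (poissonMeasure (Real.toNNReal l)) (Real.log l) Set.univ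
      (fun n x => c * (1 - Real.log l) * l
        - (1 - Real.log ((S n (fun t => (x t : ℝ)) + c * l) / (n + c)))
            * (S n (fun t => (x t : ℝ)) + c * l)
        + Real.log (I c (c * l))
        - Real.log (I (n + c) (S n (fun t => (x t : ℝ)) + c * l)))
      (fun n x => n * l - S n (fun t => (x t : ℝ)) * Real.log l ≤
        Real.log (1 / δ) + Real.log (I c (c * l))
          - Real.log (I (n + c) (S n (fun t => (x t : ℝ)) + c * l))) := by
  have hfam : IsExplicitFamily
      (Measure.count.withDensity fun k : ℕ => ENNReal.ofReal (1 / (Nat.factorial k : ℝ)))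
      (fun k : ℕ => (k : ℝ)) Set.univ Real.exp Real.exp :=
    { isOpen := isOpen_univ
      integral_eq := fun θ _ => by simpa [mul_comm] using integral_exp_count_factorial θ
      not_integrable := fun θ hθ => absurd (Set.mem_univ θ) hθ
      hasGradientAt := fun θ _ => (Real.hasDerivAt_exp θ).hasGradientAt'
      injOn := Real.exp_injective.injOn }
  have hS : ∀ (n : ℕ) (x : ℕ → ℕ), 0 ≤ S n (fun t => (x t : ℝ)) := fun n x =>
    Finset.sum_nonneg fun _ _ => Nat.cast_nonneg _
  refine ExplicitSet.of_isExplicitFamily hfam (by fun_prop) subset_rfl (by simp) hc hδ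
    (Set.mem_univ _) ?_ (by simp)
    (fun n x => Real.log ((S n (fun t => (x t : ℝ)) + c * l) / (n + c)))
    (fun a θ => Real.exp (a * (1 - θ) * Real.exp θ) * I a (a * Real.exp θ)) ?_ ?_ ?_ ?_
  · refine Measure.ext_of_singleton fun k => ?_
    rw [withDensity_apply _ (measurableSet_singleton k), lintegral_singleton,
      withDensity_apply _ (measurableSet_singleton k), lintegral_singleton,
      poissonMeasure_singleton, Measure.count_singleton, mul_one,
      ← ENNReal.ofReal_mul (Real.exp_nonneg _)]
    congr 1
    rw [Real.coe_toNNReal _ hl.le, Real.exp_log hl, sub_eq_add_neg, Real.exp_add]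
    simp only [RCLike.inner_apply, conj_trivial]
    rw [Real.exp_nat_mul, Real.exp_log hl]
    ring
  · intro n x _
    have hn : 0 < (n : ℝ) + c := by positivity
    have h0 := hS n x
    refine ⟨Set.mem_univ _, ?_⟩
    rw [Real.exp_log hl, Real.exp_log (by positivity), smul_eq_mul, smul_eq_mul, S]
    field_simp
  · intro a ha θ _
    refine ⟨mul_pos (Real.exp_pos _) (I_pos ha (by positivity)), ?_⟩
    rw [I, ← integral_const_mul]
    congr 1
    funext θ'
    rw [← Real.exp_add]
    congr 1
    simp only [RCLike.inner_apply, conj_trivial]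
    ring
  · intro n x _
    have hn : 0 < (n : ℝ) + c := by positivity
    have h0 := hS n x
    have h1 : ((n : ℝ) + c) * ((S n (fun t => (x t : ℝ)) + c * l) / (n + c))
        = S n (fun t => (x t : ℝ)) + c * l := by field_simp
    have hI1 : 0 < I c (c * l) := I_pos hc (by positivity)
    have hI2 : 0 < I (n + c) (S n (fun t => (x t : ℝ)) + c * l) := I_pos hn (by positivity)
    rw [Real.exp_log hl, Real.exp_log (by positivity), h1,
      Real.log_div (by positivity) (by positivity), Real.log_mul (by positivity) (by positivity),
      Real.log_mul (by positivity) (by positivity), Real.log_exp, Real.log_exp,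
      mul_right_comm ((n : ℝ) + c), h1]
    ring
  · intro n x _
    have hn : 0 < (n : ℝ) + c := by positivity
    have h0 := hS n x
    have e : ((n : ℝ) + c) * (Real.exp (Real.log l)
        - Real.exp (Real.log ((S n (fun t => (x t : ℝ)) + c * l) / (n + c)))
        - inner ℝ (Real.log l - Real.log ((S n (fun t => (x t : ℝ)) + c * l) / (n + c)))
          (Real.exp (Real.log ((S n (fun t => (x t : ℝ)) + c * l) / (n + c)))))
        = (n + c) * l - (S n (fun t => (x t : ℝ)) + c * l) * (1 + Real.log l
          - Real.log ((S n (fun t => (x t : ℝ)) + c * l) / (n + c))) := by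
      rw [Real.exp_log hl, Real.exp_log (by positivity)]
      simp only [RCLike.inner_apply, conj_trivial]
      field_simp
      ring
    rw [e]
    constructor <;> intro h <;> linarith

end Poisson

/-! ### Bernoulli distribution -/

section Bernoulli

lemma log_sigmoid (θ : ℝ) : Real.log (Real.sigmoid θ) = θ - Real.log (1 + Real.exp θ) := by
  have h : Real.sigmoid θ = Real.exp θ / (1 + Real.exp θ) := by
    rw [Real.sigmoid_def, Real.exp_neg]
    field_simp
    ring
  rw [h, Real.log_div (by positivity) (by positivity), Real.log_exp]

lemma log_one_sub_sigmoid (θ : ℝ) :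
    Real.log (1 - Real.sigmoid θ) = -Real.log (1 + Real.exp θ) := by
  rw [← Real.sigmoid_neg, Real.sigmoid_def, neg_neg, Real.log_inv]

lemma sigmoid_log_div_one_sub {p : ℝ} (h0 : 0 < p) (h1 : p < 1) :
    Real.sigmoid (Real.log (p / (1 - p))) = p := by
  have h2 : 0 < 1 - p := sub_pos.2 h1
  rw [Real.sigmoid_def, Real.exp_neg, Real.exp_log (by positivity)]
  field_simp
  ring

/-- The entropy is the negative of the convex conjugate of the log-partition function. -/
lemma binEntropy_sigmoid (θ : ℝ) :
    Real.binEntropy (Real.sigmoid θ) = Real.log (1 + Real.exp θ) - θ * Real.sigmoid θ := by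
  rw [Real.binEntropy, Real.log_inv, Real.log_inv, log_sigmoid, log_one_sub_sigmoid]
  ring

lemma integral_Ioo_rpow_mul_one_sub_rpow {α β : ℝ} (hα : 0 < α) (hβ : 0 < β) :
    ∫ x in Set.Ioo (0 : ℝ) 1, x ^ (α - 1) * (1 - x) ^ (β - 1) = beta α β := by
  have hb := beta_pos hα hβ
  have h := lintegral_betaPDF_eq_one hα hβ
  rw [lintegral_betaPDF] at h
  have h1 : ∫ x in Set.Ioo (0 : ℝ) 1, 1 / beta α β * x ^ (α - 1) * (1 - x) ^ (β - 1) = 1 := by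
    rw [integral_eq_lintegral_of_nonneg_ae, h, ENNReal.toReal_one]
    · filter_upwards [ae_restrict_mem measurableSet_Ioo] with x hx
      have h1 : 0 < 1 - x := sub_pos.2 hx.2
      have h2 := hx.1
      simp only [Pi.zero_apply]
      positivity
    · exact Measurable.aestronglyMeasurable (by fun_prop)
  simp only [mul_assoc, integral_const_mul] at h1
  field_simp at h1
  exact h1

/-- The substitution `u = sigmoid θ` turns the mixture integral into a Beta integral. -/
lemma integral_exp_mul_sub_log_one_add_exp {α β : ℝ} (hα : 0 < α) (hβ : 0 < β) :
    ∫ θ : ℝ, Real.exp (α * θ - (α + β) * Real.log (1 + Real.exp θ)) = beta α β := by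
  rw [← integral_Ioo_rpow_mul_one_sub_rpow hα hβ, ← Real.range_sigmoid, ← Set.image_univ,
    integral_image_eq_integral_abs_deriv_smul MeasurableSet.univ
      (fun x _ => (Real.hasDerivAt_sigmoid x).hasDerivWithinAt) Real.sigmoid_injective.injOn,
    Measure.restrict_univ]
  congr 1
  funext θ
  have h1 := Real.sigmoid_pos θ
  have h2 : 0 < 1 - Real.sigmoid θ := sub_pos.2 (Real.sigmoid_lt_one θ)
  rw [abs_of_pos (by positivity), smul_eq_mul, Real.rpow_sub_one h1.ne', Real.rpow_sub_one h2.ne',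
    Real.rpow_def_of_pos h1, Real.rpow_def_of_pos h2, log_sigmoid, log_one_sub_sigmoid]
  field_simp
  rw [← Real.exp_add]
  congr 1
  ring

lemma isExplicitFamily_bernoulli :
    IsExplicitFamily (Measure.dirac 0 + Measure.dirac 1 : Measure ℝ) (fun x : ℝ => x)
      Set.univ (fun θ => Real.log (1 + Real.exp θ)) Real.sigmoid where
  isOpen := isOpen_univ
  integral_eq θ _ := by
    rw [integral_add_measure (integrable_dirac (by simp)) (integrable_dirac (by simp)),
      integral_dirac, integral_dirac, Real.exp_log (by positivity)]
    simp
  not_integrable θ hθ := absurd (Set.mem_univ θ) hθ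
  hasGradientAt θ _ := by
    have h := (((Real.hasDerivAt_exp θ).const_add 1).log (by positivity)).hasGradientAt'
    convert h using 1
    rw [Real.sigmoid_def, Real.exp_neg]
    field_simp
    ring
  injOn := Real.sigmoid_injective.injOn

theorem explicitSet_bernoulli {Ω : Type*} [MeasurableSpace Ω] (P : Measure Ω)
    [IsProbabilityMeasure P] {c δ : ℝ} (hc : 0 < c) (hδ : 0 < δ) (μ : unitInterval)
    (h0 : 0 < (μ : ℝ)) (h1 : (μ : ℝ) < 1) :
    ExplicitSet P
      (Measure.dirac 0 + Measure.dirac 1 : Measure ℝ) (fun x : ℝ => x)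
      (Set.univ : Set ℝ) volume c δ
      (bernoulliMeasure (1 : ℝ) 0 μ) (Real.log (μ / (1 - μ))) {0, 1}
      (fun n x => c * Real.binEntropy μ
        - (n + c) * Real.binEntropy ((S n x + c * μ) / (n + c))
        + Real.log (beta (c * μ) (c * (1 - μ)) /
            beta (S n x + c * μ) (n - S n x + c * (1 - μ))))
      (fun n x => S n x * Real.log (1 / μ)
          + (n - S n x) * Real.log (1 / (1 - μ))
          + Real.log (Real.Gamma (S n x + c * μ)
              * Real.Gamma (n - S n x + c * (1 - μ))
              / (Real.Gamma (c * μ) * Real.Gamma (c * (1 - μ)))) ≤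
        Real.log (1 / δ) + Real.log (Real.Gamma (n + c) / Real.Gamma c)) := by
  have h2 : 0 < 1 - (μ : ℝ) := sub_pos.2 h1
  have hS : ∀ (n : ℕ) (x : ℕ → ℝ), (∀ t < n, x t ∈ ({0, 1} : Set ℝ)) →
      0 ≤ S n x ∧ 0 ≤ n - S n x := by
    intro n x hx
    have hx' : ∀ t ∈ Finset.range n, 0 ≤ x t ∧ x t ≤ 1 := by
      intro t ht
      rcases hx t (Finset.mem_range.1 ht) with h | h <;> rw [h] <;> norm_num
    refine ⟨Finset.sum_nonneg fun t ht => (hx' t ht).1, ?_⟩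
    have := Finset.sum_le_sum fun t ht => (hx' t ht).2
    simp only [Finset.sum_const, Finset.card_range, nsmul_eq_mul, mul_one] at this
    exact sub_nonneg.2 this
  have hσ := sigmoid_log_div_one_sub h0 h1
  -- the regularized mean lies strictly between `0` and `1`
  have hm : ∀ (n : ℕ) (x : ℕ → ℝ), (∀ t < n, x t ∈ ({0, 1} : Set ℝ)) →
      0 < (S n x + c * μ) / (n + c) ∧ (S n x + c * μ) / (n + c) < 1 := by
    intro n x hx
    obtain ⟨hS0, hS1⟩ := hS n x hx
    have hn : 0 < (n : ℝ) + c := by positivity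
    refine ⟨by positivity, ?_⟩
    rw [div_lt_one hn]
    nlinarith
  refine ExplicitSet.of_isExplicitFamily isExplicitFamily_bernoulli measurable_id subset_rfl
    (by simp) hc hδ (Set.mem_univ _) ?_ ?_
    (fun n x => Real.log ((S n x + c * μ) / (n + c) / (1 - (S n x + c * μ) / (n + c))))
    (fun a θ => Real.exp (a * Real.binEntropy (Real.sigmoid θ))
      * beta (a * Real.sigmoid θ) (a * (1 - Real.sigmoid θ))) ?_ ?_ ?_ ?_
  · have e1 : Real.exp (Real.log (1 + Real.exp (Real.log (μ / (1 - μ))))) = (1 - (μ : ℝ))⁻¹ := by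
      rw [Real.exp_log (by positivity), Real.exp_log (by positivity)]
      field_simp
      ring
    have d0 : ENNReal.ofReal (Real.exp (inner ℝ (Real.log (μ / (1 - μ))) (0 : ℝ)
        - Real.log (1 + Real.exp (Real.log (μ / (1 - μ))))))
        = ((unitInterval.toNNReal (unitInterval.symm μ) : NNReal) : ENNReal) := by
      rw [Real.exp_sub, e1, inner_zero_right, Real.exp_zero, one_div, inv_inv,
        ← unitInterval.coe_symm_eq, ← unitInterval.coe_toNNReal, ENNReal.ofReal_coe_nnreal]
    have d1 : ENNReal.ofReal (Real.exp (inner ℝ (Real.log (μ / (1 - μ))) (1 : ℝ)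
        - Real.log (1 + Real.exp (Real.log (μ / (1 - μ))))))
        = ((unitInterval.toNNReal μ : NNReal) : ENNReal) := by
      have : Real.exp (Real.log (μ / (1 - μ)) - Real.log (1 + Real.exp (Real.log (μ / (1 - μ)))))
          = (μ : ℝ) := by
        rw [Real.exp_sub, e1, Real.exp_log (by positivity)]
        field_simp
      rw [RCLike.inner_apply, conj_trivial, one_mul, this, ← unitInterval.coe_toNNReal,
        ENNReal.ofReal_coe_nnreal]
    rw [withDensity_add_measure, dirac_withDensity, dirac_withDensity, d0, d1, bernoulliMeasure_def,
      add_comm]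
    rfl
  · rw [bernoulliMeasure_def, ae_add_measure_iff]
    constructor
    · exact Measure.ae_smul_measure (by simp [ae_dirac_eq]) _
    · exact Measure.ae_smul_measure (by simp [ae_dirac_eq]) _
  · intro n x hx
    obtain ⟨hm0, hm1⟩ := hm n x hx
    refine ⟨Set.mem_univ _, ?_⟩
    rw [sigmoid_log_div_one_sub hm0 hm1, hσ, smul_eq_mul, smul_eq_mul, S]
    ring
  · intro a ha θ _
    have hp := Real.sigmoid_pos θ
    have hq : 0 < 1 - Real.sigmoid θ := sub_pos.2 (Real.sigmoid_lt_one θ)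
    refine ⟨mul_pos (Real.exp_pos _) (beta_pos (by positivity) (by positivity)), ?_⟩
    rw [← integral_exp_mul_sub_log_one_add_exp (by positivity) (by positivity),
      ← integral_const_mul]
    congr 1
    funext θ'
    rw [← Real.exp_add, binEntropy_sigmoid]
    congr 1
    simp only [RCLike.inner_apply, conj_trivial]
    ring
  · intro n x hx
    have hn : 0 < (n : ℝ) + c := by positivity
    obtain ⟨hm0, hm1⟩ := hm n x hx
    obtain ⟨hS0, hS1⟩ := hS n x hx
    have e1 : ((n : ℝ) + c) * ((S n x + c * μ) / (n + c)) = S n x + c * μ := by field_simp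
    have e2 : ((n : ℝ) + c) * (1 - (S n x + c * μ) / (n + c)) = n - S n x + c * (1 - μ) := by
      field_simp
      ring
    have hb1 : 0 < beta (c * μ) (c * (1 - μ)) := beta_pos (by positivity) (by positivity)
    have hb2 : 0 < beta (S n x + c * μ) (n - S n x + c * (1 - μ)) :=
      beta_pos (by positivity) (by positivity)
    rw [sigmoid_log_div_one_sub hm0 hm1, hσ, e1, e2,
      Real.log_div (by positivity) (by positivity), Real.log_mul (by positivity) (by positivity),
      Real.log_mul (by positivity) (by positivity), Real.log_exp, Real.log_exp,
      Real.log_div hb1.ne' hb2.ne']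
    ring
  · intro n x hx
    have hn : 0 < (n : ℝ) + c := by positivity
    obtain ⟨hm0, hm1⟩ := hm n x hx
    obtain ⟨hS0, hS1⟩ := hS n x hx
    have hA : ∀ p : ℝ, 0 < p → p < 1 →
        Real.log (1 + Real.exp (Real.log (p / (1 - p)))) = -Real.log (1 - p) := by
      intro p hp0 hp1
      have := log_one_sub_sigmoid (Real.log (p / (1 - p)))
      rw [sigmoid_log_div_one_sub hp0 hp1] at this
      linarith
    have g1 : 0 < Real.Gamma (c * μ) := Real.Gamma_pos_of_pos (by positivity)
    have g2 : 0 < Real.Gamma (c * (1 - μ)) := Real.Gamma_pos_of_pos (by positivity)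
    have g3 : 0 < Real.Gamma (S n x + c * μ) := Real.Gamma_pos_of_pos (by positivity)
    have g4 : 0 < Real.Gamma (n - S n x + c * (1 - μ)) := Real.Gamma_pos_of_pos (by positivity)
    have g5 : 0 < Real.Gamma (n + c) := Real.Gamma_pos_of_pos hn
    have g6 : 0 < Real.Gamma c := Real.Gamma_pos_of_pos hc
    have e1 : c * (μ : ℝ) + c * (1 - μ) = c := by ring
    have e2 : S n x + c * (μ : ℝ) + (n - S n x + c * (1 - μ)) = n + c := by ring
    have hβ : Real.log (beta (c * μ) (c * (1 - μ))
          / beta (S n x + c * μ) (n - S n x + c * (1 - μ)))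
        = Real.log (Real.Gamma (n + c) / Real.Gamma c)
          - Real.log (Real.Gamma (S n x + c * μ) * Real.Gamma (n - S n x + c * (1 - μ))
            / (Real.Gamma (c * μ) * Real.Gamma (c * (1 - μ)))) := by
      rw [beta, beta, e1, e2, ← Real.log_div (by positivity) (by positivity)]
      congr 1
      field_simp
    have hSn : S n x = (n + c) * ((S n x + c * μ) / (n + c)) - c * μ := by field_simp; ring
    rw [hβ, sigmoid_log_div_one_sub hm0 hm1, hA _ hm0 hm1, hA _ h0 h1,
      Real.log_div h0.ne' h2.ne', Real.log_div hm0.ne' (sub_pos.2 hm1).ne', one_div (μ : ℝ),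
      one_div (1 - (μ : ℝ)), Real.log_inv, Real.log_inv, Real.binEntropy, Real.binEntropy,
      Real.log_inv, Real.log_inv, Real.log_inv, Real.log_inv]
    simp only [RCLike.inner_apply, conj_trivial]
    generalize Real.log (_ / (Real.Gamma (c * μ) * Real.Gamma (c * (1 - μ)))) = R at *
    generalize (S n x + c * μ) / (n + c) = m at *
    rw [hSn]
    constructor <;> intro h <;> linarith

end Bernoulli

/-! ### The digamma function -/

section Digamma

lemma differentiableAt_log_Gamma {x : ℝ} (hx : 0 < x) :
    DifferentiableAt ℝ (fun y => Real.log (Real.Gamma y)) x :=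
  (Real.differentiableAt_Gamma fun m => by
    have : (0 : ℝ) ≤ m := Nat.cast_nonneg m
    linarith).log (Real.Gamma_pos_of_pos hx).ne'

lemma hasDerivAt_log_Gamma {x : ℝ} (hx : 0 < x) :
    HasDerivAt (fun y => Real.log (Real.Gamma y)) (digamma x) x :=
  (differentiableAt_log_Gamma hx).hasDerivAt

lemma digamma_add_one {x : ℝ} (hx : 0 < x) : digamma (x + 1) = digamma x + 1 / x := by
  have h1 : HasDerivAt (fun y => Real.log (Real.Gamma (y + 1))) (digamma (x + 1)) x :=
    (hasDerivAt_log_Gamma (by positivity)).comp_add_const x 1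
  have h2 : HasDerivAt (fun y => Real.log y + Real.log (Real.Gamma y)) (x⁻¹ + digamma x) x :=
    (Real.hasDerivAt_log hx.ne').add (hasDerivAt_log_Gamma hx)
  have h3 : (fun y => Real.log (Real.Gamma (y + 1)))
      =ᶠ[nhds x] fun y => Real.log y + Real.log (Real.Gamma y) := by
    filter_upwards [lt_mem_nhds hx] with y hy
    rw [Real.Gamma_add_one hy.ne', Real.log_mul hy.ne' (Real.Gamma_pos_of_pos hy).ne']
  rw [h1.unique (h2.congr_of_eventuallyEq h3)]
  ring

lemma monotoneOn_digamma : MonotoneOn digamma (Set.Ioi 0) :=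
  Real.convexOn_log_Gamma.monotoneOn_deriv fun _ hx => differentiableAt_log_Gamma hx

/-- Strictness comes from the functional equation: `ψ(y) - ψ(x)` exceeds `ψ(y + 1) - ψ(x + 1)`,
which is nonnegative, by `1 / x - 1 / y`. -/
lemma strictMonoOn_digamma : StrictMonoOn digamma (Set.Ioi 0) := by
  intro x hx y hy hxy
  have hx' : (0 : ℝ) < x := hx
  have hy' : (0 : ℝ) < y := hy
  have h := monotoneOn_digamma (Set.mem_Ioi.2 (by positivity : 0 < x + 1))
    (Set.mem_Ioi.2 (by positivity : 0 < y + 1)) (by linarith)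
  rw [digamma_add_one hx', digamma_add_one hy'] at h
  have := one_div_lt_one_div_of_lt hx' hxy
  linarith

lemma exists_lt_digamma (m : ℝ) : ∃ x, 0 < x ∧ m < digamma x := by
  have h : ∀ n : ℕ, digamma (n + 1)
      = digamma 1 + ∑ i ∈ Finset.range n, 1 / ((i : ℝ) + 1) := by
    intro n
    induction n with
    | zero => simp
    | succ n ih =>
      rw [Finset.sum_range_succ, ← add_assoc, ← ih, Nat.cast_succ, digamma_add_one (by positivity)]
  obtain ⟨n, hn⟩ := (Real.tendsto_sum_range_one_div_nat_succ_atTop.eventually_gt_atTop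
    (m - digamma 1)).exists
  exact ⟨n + 1, by positivity, by rw [h]; linarith⟩

lemma exists_digamma_lt (m : ℝ) : ∃ x, 0 < x ∧ digamma x < m := by
  obtain ⟨x, hx0, hx1, hx⟩ : ∃ x : ℝ, 0 < x ∧ x ≤ 1 ∧ digamma 2 - m < 1 / x := by
    refine ⟨1 / (|digamma 2 - m| + 1), by positivity, ?_, ?_⟩
    · rw [div_le_one (by positivity)]
      linarith [abs_nonneg (digamma 2 - m)]
    · rw [one_div_one_div]
      linarith [le_abs_self (digamma 2 - m)]
  refine ⟨x, hx0, ?_⟩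
  have h := monotoneOn_digamma (Set.mem_Ioi.2 (by positivity : 0 < x + 1))
    (Set.mem_Ioi.2 (by norm_num : (0 : ℝ) < 2)) (by linarith)
  rw [digamma_add_one hx0] at h
  linarith

lemma exists_digamma_eq (m : ℝ) : ∃ x ∈ Set.Ioi (0 : ℝ), digamma x = m := by
  obtain ⟨x, hx, hxm⟩ := exists_digamma_lt m
  obtain ⟨y, hy, hym⟩ := exists_lt_digamma m
  -- derivatives have the intermediate value property
  have h : (digamma '' Set.Ioi 0).OrdConnected :=
    Set.OrdConnected.image_deriv Set.ordConnected_Ioi fun _ hx => differentiableAt_log_Gamma hx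
  exact h.out ⟨x, hx, rfl⟩ ⟨y, hy, rfl⟩ ⟨hxm.le, hym.le⟩

lemma log_Gamma_add_digamma_mul_le {x y : ℝ} (hx : 0 < x) (hy : 0 < y) :
    Real.log (Real.Gamma x) + digamma x * (y - x) ≤ Real.log (Real.Gamma y) := by
  rcases lt_trichotomy x y with h | h | h
  · have := Real.convexOn_log_Gamma.le_slope_of_hasDerivAt hx hy h (hasDerivAt_log_Gamma hx)
    rw [slope_def_field, le_div_iff₀ (sub_pos.2 h)] at this
    simp only [Function.comp] at this
    linarith
  · simp [h]
  · have := Real.convexOn_log_Gamma.slope_le_of_hasDerivAt hy hx h (hasDerivAt_log_Gamma hx)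
    rw [slope_def_field, div_le_iff₀ (sub_pos.2 h)] at this
    simp only [Function.comp] at this
    linarith

/-- The integrands of `J` decay exponentially, because `log Γ` lies above its tangent at a point
where the slope exceeds `b / a`. -/
lemma exists_exp_log_Gamma_le {a : ℝ} (ha : 0 < a) (b : ℝ) : ∃ C r : ℝ, 0 < r ∧ ∀ y, 0 < y →
    Real.exp (-a * Real.log (Real.Gamma y) + b * y) ≤ C * Real.exp (-r * y) := by
  obtain ⟨x, hx, hbx⟩ := exists_lt_digamma (b / a)
  rw [div_lt_iff₀ ha] at hbx
  refine ⟨Real.exp (-a * (Real.log (Real.Gamma x) - digamma x * x)), digamma x * a - b,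
    sub_pos.2 hbx, fun y hy => ?_⟩
  rw [← Real.exp_add, Real.exp_le_exp]
  nlinarith [mul_le_mul_of_nonneg_left (log_Gamma_add_digamma_mul_le hx hy) ha.le]

end Digamma

/-! ### The mixture integrals of the chi-square family -/

section J

lemma continuousOn_exp_log_Gamma (a b : ℝ) :
    ContinuousOn (fun y => Real.exp (-a * Real.log (Real.Gamma y) + b * y)) (Set.Ioi 0) := by
  refine Real.continuous_exp.comp_continuousOn (ContinuousOn.add ?_ (by fun_prop))
  exact continuousOn_const.mul fun x hx =>
    (differentiableAt_log_Gamma hx).continuousAt.continuousWithinAt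

lemma integrableOn_exp_log_Gamma {a : ℝ} (ha : 0 < a) (b : ℝ) :
    IntegrableOn (fun y => Real.exp (-a * Real.log (Real.Gamma y) + b * y)) (Set.Ioi 0) := by
  obtain ⟨C, r, hr, h⟩ := exists_exp_log_Gamma_le ha b
  refine Integrable.mono' ((exp_neg_integrableOn_Ioi 0 hr).const_mul C)
    ((continuousOn_exp_log_Gamma a b).aestronglyMeasurable measurableSet_Ioi) ?_
  filter_upwards [ae_restrict_mem measurableSet_Ioi] with y hy
  rw [Real.norm_of_nonneg (Real.exp_nonneg _)]
  exact h y hy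

lemma integral_exp_log_Gamma (a b : ℝ) :
    ∫ y in Set.Ioi 0, Real.exp (-a * Real.log (Real.Gamma y) + b * y) = 1 / 2 * J a b := by
  have h := integral_comp_mul_left_Ioi
    (fun y => Real.exp (-a * Real.log (Real.Gamma y) + b * y)) 0 (by norm_num : (0 : ℝ) < 1 / 2)
  rw [mul_zero] at h
  have e : J a b = ∫ x in Set.Ioi (0 : ℝ),
      Real.exp (-a * Real.log (Real.Gamma (1 / 2 * x)) + b * (1 / 2 * x)) := by
    rw [J]
    simp only [one_div_mul_eq_div]
  rw [e, h]
  simp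

lemma J_pos {a : ℝ} (ha : 0 < a) (b : ℝ) : 0 < J a b := by
  have hne : NeZero ((volume : Measure ℝ).restrict (Set.Ioi 0)) :=
    ⟨by simp [Measure.restrict_eq_zero]⟩
  have h := integral_exp_pos (integrableOn_exp_log_Gamma ha b)
  rw [integral_exp_log_Gamma] at h
  linarith

lemma summable_exp_log_Gamma {a : ℝ} (ha : 0 < a) (b : ℝ) :
    Summable fun j : ℕ => Real.exp (-a * Real.log (Real.Gamma (((j : ℝ) + 1) / 2))
      + b * (((j : ℝ) + 1) / 2)) := by
  obtain ⟨C, r, hr, h⟩ := exists_exp_log_Gamma_le ha b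
  have hs : Summable fun j : ℕ => C * Real.exp (-r / 2) * Real.exp (j * (-r / 2)) :=
    (Real.summable_exp_nat_mul_iff.2 (by linarith)).mul_left _
  refine Summable.of_nonneg_of_le (fun _ => Real.exp_nonneg _) (fun j => ?_) hs
  refine (h _ (by positivity)).trans (le_of_eq ?_)
  rw [mul_assoc, ← Real.exp_add]
  ring_nf

lemma JNat_pos {a : ℝ} (ha : 0 < a) (b : ℝ) : 0 < JNat a b :=
  (summable_exp_log_Gamma ha b).tsum_pos (fun _ => Real.exp_nonneg _) 0 (Real.exp_pos _)

/-- Counting measure on the integer chi-square parameters, as the image of counting measure. -/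
lemma count_restrict_chiSqParams :
    (Measure.count : Measure ℝ).restrict chiSqParams
      = (Measure.count : Measure ℕ).map fun j : ℕ => ((j : ℝ) + 1) / 2 - 1 := by
  have hinj : Function.Injective fun j : ℕ => ((j : ℝ) + 1) / 2 - 1 := by
    intro i j h
    have : (i : ℝ) = j := by
      simp only at h
      linarith
    exact_mod_cast this
  have hrange : chiSqParams = Set.range fun j : ℕ => ((j : ℝ) + 1) / 2 - 1 := by
    ext θ
    constructor
    · rintro ⟨k, hk, rfl⟩
      refine ⟨k - 1, ?_⟩
      simp [Nat.cast_sub hk]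
    · rintro ⟨j, rfl⟩
      exact ⟨j + 1, by omega, by simp⟩
  ext s hs
  rw [Measure.map_apply (measurable_of_countable _) hs, Measure.restrict_apply hs, hrange,
    ← Set.image_preimage_eq_inter_range, Measure.count_injective_image hinj]

end J

/-! ### Chi-square distribution -/

section ChiSquare

lemma isExplicitFamily_chiSq :
    IsExplicitFamily ((volume.restrict (Set.Ioi (0 : ℝ))).withDensity
        fun x => ENNReal.ofReal (Real.exp (-x / 2))) (fun x : ℝ => Real.log x) (Set.Ioi (-1))
      (fun θ => Real.log (Real.Gamma (θ + 1)) + (θ + 1) * Real.log 2)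
      (fun θ => digamma (θ + 1) + Real.log 2) := by
  have hm : Measurable fun x : ℝ => Real.exp (-x / 2) := by fun_prop
  have h0 : ∀ x ∈ Set.Ioi (0 : ℝ), 0 ≤ Real.exp (-x / 2) := fun x _ => Real.exp_nonneg _
  have hpow : ∀ θ : ℝ, ∀ x ∈ Set.Ioi (0 : ℝ), Real.exp (-x / 2) * Real.exp (inner ℝ θ (Real.log x))
      = x ^ θ * Real.exp (-(1 / 2 * x)) := by
    intro θ x hx
    rw [Real.rpow_def_of_pos hx, RCLike.inner_apply, conj_trivial, mul_comm]
    ring_nf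
  refine ⟨isOpen_Ioi, ?_, ?_, ?_, ?_⟩
  · intro θ hθ
    have hθ' : 0 < θ + 1 := neg_lt_iff_pos_add.1 hθ
    have h := Real.integral_rpow_mul_exp_neg_mul_Ioi hθ' (by norm_num : (0 : ℝ) < 1 / 2)
    rw [add_sub_cancel_right] at h
    rw [integral_restrict_withDensity_ofReal measurableSet_Ioi hm h0,
      setIntegral_congr_fun measurableSet_Ioi (hpow θ), h, Real.exp_add,
      Real.exp_log (Real.Gamma_pos_of_pos hθ'), one_div_one_div, Real.rpow_def_of_pos two_pos]
    ring_nf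
  · intro θ hθ hi
    rw [integrable_restrict_withDensity_ofReal_iff measurableSet_Ioi hm h0,
      integrableOn_congr_fun (hpow θ) measurableSet_Ioi] at hi
    refine hθ ((intervalIntegral.integrableOn_Ioo_rpow_iff one_pos).1 ?_)
    refine Integrable.mono' (((hi.mono_set Set.Ioo_subset_Ioi_self)).mul_const (Real.exp (1 / 2)))
      (Measurable.aestronglyMeasurable (by fun_prop)) ?_
    filter_upwards [ae_restrict_mem measurableSet_Ioo] with x hx
    have hx0 : 0 < x := hx.1
    rw [Real.norm_of_nonneg (by positivity), mul_assoc, ← Real.exp_add]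
    exact le_mul_of_one_le_right (by positivity) (Real.one_le_exp (by linarith [hx.2]))
  · intro θ hθ
    have hθ' : 0 < θ + 1 := neg_lt_iff_pos_add.1 hθ
    have h := ((hasDerivAt_log_Gamma hθ').comp_add_const θ 1).add
      (((hasDerivAt_id θ).add_const 1).mul_const (Real.log 2))
    rw [one_mul] at h
    exact h.hasGradientAt'
  · intro θ hθ θ' hθ' h
    have := strictMonoOn_digamma.injOn (Set.mem_Ioi.2 (neg_lt_iff_pos_add.1 hθ))
      (Set.mem_Ioi.2 (neg_lt_iff_pos_add.1 hθ')) (add_right_cancel h)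
    linarith

lemma chiSqMeasure_eq {k : ℝ} (hk : 0 < k) :
    chiSqMeasure k = ((volume.restrict (Set.Ioi (0 : ℝ))).withDensity
      fun x => ENNReal.ofReal (Real.exp (-x / 2))).withDensity fun x =>
        ENNReal.ofReal (Real.exp (inner ℝ (k / 2 - 1) (Real.log x)
          - (Real.log (Real.Gamma (k / 2 - 1 + 1)) + (k / 2 - 1 + 1) * Real.log 2))) := by
  have hΓ : 0 < Real.Gamma (k / 2) := Real.Gamma_pos_of_pos (by positivity)
  have h1 : chiSqMeasure k = (volume.restrict (Set.Ici (0 : ℝ))).withDensity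
      (gammaPDF (k / 2) (1 / 2)) :=
    withDensity_ofReal_eq_restrict measurableSet_Ici (f := gammaPDFReal (k / 2) (1 / 2))
      (fun x _ => rfl) fun x hx => by rw [gammaPDFReal, if_neg (mt Set.mem_Ici.2 hx)]
  rw [h1, withDensity_ofReal_withDensity_ofReal (by fun_prop)
    (by simp only [RCLike.inner_apply, conj_trivial]; fun_prop) fun _ => Real.exp_nonneg _,
    ← restrict_Ioi_eq_restrict_Ici]
  refine withDensity_congr_ae ?_
  filter_upwards [ae_restrict_mem measurableSet_Ioi] with x hx
  have hx0 : 0 < x := hx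
  rw [gammaPDF]
  congr 1
  rw [gammaPDFReal, if_pos hx0.le, Real.rpow_def_of_pos hx0, sub_add_cancel, Real.exp_sub,
    Real.exp_add, Real.exp_log hΓ, RCLike.inner_apply, conj_trivial, one_div,
    Real.inv_rpow zero_le_two, Real.rpow_def_of_pos two_pos]
  have e : Real.exp (-(2⁻¹ * x)) = Real.exp (-x / 2) := by ring_nf
  rw [e]
  field_simp

/-- The chi-square confidence sets for any mixing measure `ν` whose mixture integrals are a fixed
multiple `r` of `Jν`. -/
lemma explicitSet_chiSq {Ω : Type*} [MeasurableSpace Ω] (P : Measure Ω) [IsProbabilityMeasure P]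
    {c δ : ℝ} (hc : 0 < c) (hδ : 0 < δ) {Θ : Set ℝ} (hΘ : Θ ⊆ Set.Ioi (-1)) (ν : Measure ℝ)
    [SFinite ν] (hν : ∀ᵐ θ ∂ν, θ ∈ Θ) {r : ℝ} (hr : 0 < r) (Jν : ℝ → ℝ → ℝ)
    (hJ : ∀ a : ℝ, 0 < a → ∀ b : ℝ, 0 < Jν a b ∧
      ∫ θ, Real.exp (-a * Real.log (Real.Gamma (θ + 1)) + b * (θ + 1)) ∂ν = r * Jν a b)
    {k : ℝ} (hk : 0 < k) (hkΘ : k / 2 - 1 ∈ Θ) :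
    ExplicitSet P
      ((volume.restrict (Set.Ioi (0 : ℝ))).withDensity
        fun x => ENNReal.ofReal (Real.exp (-x / 2))) (fun x : ℝ => Real.log x)
      Θ ν c δ (chiSqMeasure k) (k / 2 - 1) (Set.Ioi 0)
      (fun n x => chiSqEstimate c n x k / 2 * (K n x + c * digamma (k / 2))
        - (n + c) * Real.log (Real.Gamma (chiSqEstimate c n x k / 2))
        + c * Real.log (Real.Gamma (k / 2))
        - c * (k / 2) * digamma (k / 2)
        + Real.log (Jν c (c * digamma (k / 2)) / Jν (n + c) (K n x + c * digamma (k / 2))))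
      (fun n x => n * Real.log (Real.Gamma (k / 2)) - k / 2 * K n x
          - Real.log (Jν c (c * digamma (k / 2)))
          + Real.log (Jν (n + c) (K n x + c * digamma (k / 2))) ≤
        Real.log (1 / δ)) := by
  have hkn : ∀ (n : ℕ) (x : ℕ → ℝ), 0 < chiSqEstimate c n x k / 2 ∧
      digamma (chiSqEstimate c n x k / 2) = (K n x + c * digamma (k / 2)) / (n + c) := by
    intro n x
    have h := exists_digamma_eq ((K n x + c * digamma (k / 2)) / (n + c))
    rw [chiSqEstimate, mul_div_cancel_left₀ _ (two_ne_zero (α := ℝ))]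
    exact ⟨Function.invFunOn_mem h, Function.invFunOn_eq h⟩
  have hnc : ∀ n : ℕ, 0 < (n : ℝ) + c := fun n => by positivity
  have hB : ∀ (n : ℕ) (x : ℕ → ℝ), ((n : ℝ) + c) * digamma (chiSqEstimate c n x k / 2)
      = K n x + c * digamma (k / 2) := by
    intro n x
    rw [(hkn n x).2, mul_div_cancel₀ _ (hnc n).ne']
  refine ExplicitSet.of_isExplicitFamily isExplicitFamily_chiSq Real.measurable_log hΘ hν hc hδ hkΘ
    (chiSqMeasure_eq hk) ?_ (fun n x => chiSqEstimate c n x k / 2 - 1)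
    (fun a θ => Real.exp (a * (Real.log (Real.Gamma (θ + 1)) - (θ + 1) * digamma (θ + 1)))
      * (r * Jν a (a * digamma (θ + 1)))) ?_ ?_ ?_ ?_
  · rw [chiSqMeasure_eq hk]
    exact (withDensity_absolutelyContinuous _ _).ae_le
      ((withDensity_absolutelyContinuous _ _).ae_le (ae_restrict_mem measurableSet_Ioi))
  · intro n x hx
    have hK : K n x = (∑ t ∈ Finset.range n, Real.log (x t)) - n * Real.log 2 := by
      have : ∀ t ∈ Finset.range n, Real.log (x t / 2) = Real.log (x t) - Real.log 2 :=
        fun t ht => Real.log_div (hx t (Finset.mem_range.1 ht)).ne' two_ne_zero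
      rw [K, Finset.sum_congr rfl this]
      simp
    have hn := hnc n
    refine ⟨?_, ?_⟩
    · have := (hkn n x).1
      rw [Set.mem_Ioi]
      linarith
    · simp only [sub_add_cancel, smul_eq_mul]
      rw [(hkn n x).2, hK]
      field_simp
      ring
  · intro a ha θ _
    obtain ⟨hpos, hint⟩ := hJ a ha (a * digamma (θ + 1))
    refine ⟨by positivity, ?_⟩
    rw [← hint, ← integral_const_mul]
    congr 1
    funext θ'
    rw [← Real.exp_add]
    congr 1
    simp only [RCLike.inner_apply, conj_trivial]
    ring
  · intro n x _
    have h1 := (hJ c hc (c * digamma (k / 2))).1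
    have h2 := (hJ _ (hnc n) (K n x + c * digamma (k / 2))).1
    simp only [sub_add_cancel]
    rw [hB n x, Real.log_div (by positivity) (by positivity),
      Real.log_mul (by positivity) (by positivity), Real.log_exp, Real.log_mul hr.ne' h1.ne',
      Real.log_mul (by positivity) (by positivity), Real.log_exp, Real.log_mul hr.ne' h2.ne',
      Real.log_div h1.ne' h2.ne', ← hB n x]
    ring
  · intro n x _
    have h1 := (hJ c hc (c * digamma (k / 2))).1
    have h2 := (hJ _ (hnc n) (K n x + c * digamma (k / 2))).1
    have hB' := hB n x
    simp only [sub_add_cancel, RCLike.inner_apply, conj_trivial]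
    rw [Real.log_div h1.ne' h2.ne']
    have e : ((n : ℝ) + c) * (Real.log (Real.Gamma (k / 2)) + k / 2 * Real.log 2
        - (Real.log (Real.Gamma (chiSqEstimate c n x k / 2))
          + chiSqEstimate c n x k / 2 * Real.log 2)
        - (digamma (chiSqEstimate c n x k / 2) + Real.log 2)
          * (k / 2 - 1 - (chiSqEstimate c n x k / 2 - 1)))
        = (n + c) * (Real.log (Real.Gamma (k / 2))
            - Real.log (Real.Gamma (chiSqEstimate c n x k / 2)))
          - (K n x + c * digamma (k / 2)) * (k / 2 - chiSqEstimate c n x k / 2) := by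
      rw [← hB']
      ring
    rw [e]
    constructor <;> intro h <;> linarith

theorem explicitSet_chiSq_real {Ω : Type*} [MeasurableSpace Ω] (P : Measure Ω)
    [IsProbabilityMeasure P] {c δ : ℝ} (hc : 0 < c) (hδ : 0 < δ) (k : ℝ) (hk : 0 < k) :
    ExplicitSet P
      ((volume.restrict (Set.Ioi (0 : ℝ))).withDensity
        fun x => ENNReal.ofReal (Real.exp (-x / 2))) (fun x : ℝ => Real.log x)
      (Set.Ioi (-1 : ℝ)) (volume.restrict (Set.Ioi (-1))) c δ
      (chiSqMeasure k) (k / 2 - 1) (Set.Ioi 0)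
      (fun n x => chiSqEstimate c n x k / 2 * (K n x + c * digamma (k / 2))
        - (n + c) * Real.log (Real.Gamma (chiSqEstimate c n x k / 2))
        + c * Real.log (Real.Gamma (k / 2))
        - c * (k / 2) * digamma (k / 2)
        + Real.log (J c (c * digamma (k / 2)) / J (n + c) (K n x + c * digamma (k / 2))))
      (fun n x => n * Real.log (Real.Gamma (k / 2)) - k / 2 * K n x
          - Real.log (J c (c * digamma (k / 2)))
          + Real.log (J (n + c) (K n x + c * digamma (k / 2))) ≤
        Real.log (1 / δ)) := by
  refine explicitSet_chiSq P hc hδ subset_rfl _ (ae_restrict_mem measurableSet_Ioi)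
    (by norm_num : (0 : ℝ) < 1 / 2) J (fun a ha b => ⟨J_pos ha b, ?_⟩) hk ?_
  · rw [← integral_exp_log_Gamma, ← integral_indicator measurableSet_Ioi,
      ← integral_indicator measurableSet_Ioi, ← integral_add_right_eq_self (μ := volume)
        ((Set.Ioi (0 : ℝ)).indicator
          fun y => Real.exp (-a * Real.log (Real.Gamma y) + b * y)) 1]
    congr 1
    funext θ
    by_cases h : -1 < θ
    · rw [Set.indicator_of_mem (Set.mem_Ioi.2 h),
        Set.indicator_of_mem (Set.mem_Ioi.2 (neg_lt_iff_pos_add.1 h))]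
    · rw [Set.indicator_of_notMem (mt Set.mem_Ioi.1 h),
        Set.indicator_of_notMem (mt (fun h' => neg_lt_iff_pos_add.2 (Set.mem_Ioi.1 h')) h)]
  · rw [Set.mem_Ioi]
    linarith

theorem explicitSet_chiSq_nat {Ω : Type*} [MeasurableSpace Ω] (P : Measure Ω)
    [IsProbabilityMeasure P] {c δ : ℝ} (hc : 0 < c) (hδ : 0 < δ) (k : ℕ) (hk : 1 ≤ k) :
    ExplicitSet P
      ((volume.restrict (Set.Ioi (0 : ℝ))).withDensity
        fun x => ENNReal.ofReal (Real.exp (-x / 2))) (fun x : ℝ => Real.log x)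
      chiSqParams (Measure.count.restrict chiSqParams) c δ
      (chiSqMeasure k) ((k : ℝ) / 2 - 1) (Set.Ioi 0)
      (fun n x => chiSqEstimate c n x k / 2 * (K n x + c * digamma ((k : ℝ) / 2))
        - (n + c) * Real.log (Real.Gamma (chiSqEstimate c n x k / 2))
        + c * Real.log (Real.Gamma ((k : ℝ) / 2))
        - c * ((k : ℝ) / 2) * digamma ((k : ℝ) / 2)
        + Real.log (JNat c (c * digamma ((k : ℝ) / 2)) /
            JNat (n + c) (K n x + c * digamma ((k : ℝ) / 2))))
      (fun n x => n * Real.log (Real.Gamma ((k : ℝ) / 2)) - (k : ℝ) / 2 * K n x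
          - Real.log (JNat c (c * digamma ((k : ℝ) / 2)))
          + Real.log (JNat (n + c) (K n x + c * digamma ((k : ℝ) / 2))) ≤
        Real.log (1 / δ)) := by
  have hfin : SFinite ((Measure.count : Measure ℝ).restrict chiSqParams) := by
    rw [count_restrict_chiSqParams]
    infer_instance
  have hmem : ∀ j : ℕ, ((j : ℝ) + 1) / 2 - 1 ∈ chiSqParams := fun j =>
    ⟨j + 1, by omega, by simp⟩
  have hk' : (0 : ℝ) < k := Nat.cast_pos.2 hk
  refine explicitSet_chiSq P hc hδ ?_ _ ?_ one_pos JNat (fun a ha b => ⟨JNat_pos ha b, ?_⟩) hk'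
    ⟨k, hk, rfl⟩
  · rintro θ ⟨j, hj, rfl⟩
    have : (0 : ℝ) < j := Nat.cast_pos.2 hj
    rw [Set.mem_Ioi]
    linarith
  · have hms : MeasurableSet chiSqParams := by
      have : chiSqParams.Countable := by
        refine (Set.countable_range fun k : ℕ => (k : ℝ) / 2 - 1).mono ?_
        rintro θ ⟨j, -, rfl⟩
        exact ⟨j, rfl⟩
      exact this.measurableSet
    exact ae_restrict_mem hms
  · have hemb : MeasurableEmbedding fun j : ℕ => ((j : ℝ) + 1) / 2 - 1 := by
      refine Measurable.measurableEmbedding (measurable_of_countable _) fun i j h => ?_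
      have h' : ((i : ℝ) + 1) / 2 - 1 = ((j : ℝ) + 1) / 2 - 1 := h
      have : (i : ℝ) = j := by linarith
      exact_mod_cast this
    have hs := summable_exp_log_Gamma ha b
    rw [count_restrict_chiSqParams, hemb.integral_map, one_mul, JNat]
    simp only [sub_add_cancel]
    rw [integral_countable (integrable_count_iff.2 hs.norm)]
    simp

end ChiSquare

/-! ### Gaussian with unknown mean and variance -/

section Gaussian2

lemma integral_exp_neg_mul_sq_add_mul {b : ℝ} (hb : 0 < b) (d : ℝ) :
    ∫ x : ℝ, Real.exp (-b * x ^ 2 + d * x) = Real.exp (d ^ 2 / (4 * b)) * √(Real.pi / b) := by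
  rw [← integral_gaussian, ← integral_sub_right_eq_self (μ := volume)
    (fun x : ℝ => Real.exp (-b * x ^ 2)) (d / (2 * b)), ← integral_const_mul]
  congr 1
  funext x
  rw [← Real.exp_add]
  congr 1
  field_simp
  ring

lemma inner_euclideanSpace_two (θ : EuclideanSpace ℝ (Fin 2)) (x y : ℝ) :
    inner ℝ θ !₂[x, y] = θ 0 * x + θ 1 * y := by
  simp [PiLp.inner_apply, Fin.sum_univ_two, mul_comm]

/-- The log-partition function of the two-parameter Gaussian family. -/
noncomputable def gaussLogPartition (θ : EuclideanSpace ℝ (Fin 2)) : ℝ :=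
  -(1 / 4) * (θ 0 ^ 2 * (θ 1)⁻¹) - 1 / 2 * Real.log (-θ 1)

/-- The mean of the feature `(x, x²)`, i.e. the first two moments, at the natural parameter `θ`. -/
noncomputable def gaussMoments (θ : EuclideanSpace ℝ (Fin 2)) : EuclideanSpace ℝ (Fin 2) :=
  !₂[-(1 / 2) * (θ 0 * (θ 1)⁻¹), 1 / 4 * (θ 0 ^ 2 * (θ 1)⁻¹ ^ 2) - 1 / 2 * (θ 1)⁻¹]

/-- The natural parameter of the Gaussian distribution with mean `m` and variance `v`. -/
noncomputable def gaussNatural (m v : ℝ) : EuclideanSpace ℝ (Fin 2) := !₂[m / v, -1 / (2 * v)]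

lemma gaussNatural_mem {m v : ℝ} (hv : 0 < v) : gaussNatural m v ∈ gaussParams := by
  change -1 / (2 * v) < 0
  exact div_neg_of_neg_of_pos (by norm_num) (by positivity)

lemma exists_eq_gaussNatural {θ : EuclideanSpace ℝ (Fin 2)} (hθ : θ ∈ gaussParams) :
    ∃ m v, 0 < v ∧ θ = gaussNatural m v := by
  have h : θ 1 < 0 := hθ
  refine ⟨-θ 0 / (2 * θ 1), -1 / (2 * θ 1), div_pos_of_neg_of_neg (by norm_num) (by linarith), ?_⟩
  have h' := h.ne
  ext i
  fin_cases i
  · simp [gaussNatural]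
    field_simp
  · simp [gaussNatural]
    field_simp

lemma gaussLogPartition_gaussNatural {m v : ℝ} (hv : 0 < v) :
    gaussLogPartition (gaussNatural m v) = m ^ 2 / (2 * v) + 1 / 2 * Real.log (2 * v) := by
  have h : -(-1 / (2 * v)) = (2 * v)⁻¹ := by field_simp
  simp only [gaussLogPartition, gaussNatural, Matrix.cons_val_zero, Matrix.cons_val_one, h,
    Real.log_inv, PiLp.toLp_apply]
  field_simp
  ring

lemma gaussMoments_gaussNatural {m v : ℝ} (hv : 0 < v) :
    gaussMoments (gaussNatural m v) = !₂[m, m ^ 2 + v] := by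
  simp only [gaussMoments, gaussNatural, Matrix.cons_val_zero, Matrix.cons_val_one,
    PiLp.toLp_apply]
  congr 2
  · field_simp
  · congr 1
    field_simp
    ring

lemma hasGradientAt_gaussLogPartition {θ : EuclideanSpace ℝ (Fin 2)} (hθ : θ ∈ gaussParams) :
    HasGradientAt gaussLogPartition (gaussMoments θ) θ := by
  have h1 : θ 1 < 0 := hθ
  have p0 : HasFDerivAt (fun θ : EuclideanSpace ℝ (Fin 2) => θ 0)
      (EuclideanSpace.proj 0 : EuclideanSpace ℝ (Fin 2) →L[ℝ] ℝ) θ :=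
    (EuclideanSpace.proj 0 : EuclideanSpace ℝ (Fin 2) →L[ℝ] ℝ).hasFDerivAt
  have p1 : HasFDerivAt (fun θ : EuclideanSpace ℝ (Fin 2) => θ 1)
      (EuclideanSpace.proj 1 : EuclideanSpace ℝ (Fin 2) →L[ℝ] ℝ) θ :=
    (EuclideanSpace.proj 1 : EuclideanSpace ℝ (Fin 2) →L[ℝ] ℝ).hasFDerivAt
  have h := ((((p0.pow 2).mul ((hasDerivAt_inv h1.ne).comp_hasFDerivAt θ p1)).const_mul
    (-(1 / 4) : ℝ)).sub ((p1.neg.log (neg_pos.2 h1).ne').const_mul (1 / 2 : ℝ)))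
  rw [hasGradientAt_iff_hasFDerivAt]
  refine h.congr_fderiv ?_
  ext v
  have h2 := h1.ne
  simp [gaussMoments, PiLp.inner_apply, Fin.sum_univ_two]
  field_simp
  ring

lemma isExplicitFamily_gauss :
    IsExplicitFamily (ENNReal.ofReal (1 / √Real.pi) • (volume : Measure ℝ))
      (fun x : ℝ => (!₂[x, x ^ 2] : EuclideanSpace ℝ (Fin 2))) gaussParams
      gaussLogPartition gaussMoments where
  isOpen := isOpen_lt (EuclideanSpace.proj 1 : EuclideanSpace ℝ (Fin 2) →L[ℝ] ℝ).continuous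
    continuous_const
  integral_eq θ hθ := by
    have h1 : 0 < -θ 1 := neg_pos.2 hθ
    have h2 : θ 1 ≠ 0 := (show θ 1 < 0 from hθ).ne
    have e : ∀ x : ℝ, inner ℝ θ (!₂[x, x ^ 2] : EuclideanSpace ℝ (Fin 2))
        = -(-θ 1) * x ^ 2 + θ 0 * x := by
      intro x
      rw [inner_euclideanSpace_two]
      ring
    have e2 : Real.exp (1 / 2 * Real.log (-θ 1)) = √(-θ 1) := by
      rw [Real.sqrt_eq_rpow, Real.rpow_def_of_pos h1, mul_comm]
    simp only [e]
    rw [integral_smul_measure, integral_exp_neg_mul_sq_add_mul h1,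
      ENNReal.toReal_ofReal (by positivity), smul_eq_mul, gaussLogPartition, Real.exp_sub, e2,
      Real.sqrt_div Real.pi_nonneg]
    have e3 : θ 0 ^ 2 / (4 * -θ 1) = -(1 / 4) * (θ 0 ^ 2 * (θ 1)⁻¹) := by
      field_simp
    rw [e3]
    have : 0 < √(-θ 1) := Real.sqrt_pos.2 h1
    field_simp
  not_integrable θ hθ hi := by
    have h1 : 0 ≤ θ 1 := not_lt.1 hθ
    rw [integrable_smul_measure (by simp; positivity) ENNReal.ofReal_ne_top] at hi
    -- one of the values at `x` and `-x` is at least `1`, so `1` would be integrable on the line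
    have h2 : Integrable (fun _ : ℝ => (1 : ℝ)) := by
      refine (hi.add hi.comp_neg).mono' (by fun_prop) (ae_of_all _ fun x => ?_)
      simp only [Pi.add_apply, inner_euclideanSpace_two, norm_one]
      rcases le_total 0 (θ 0 * x) with h | h
      · have := Real.one_le_exp (add_nonneg h (mul_nonneg h1 (sq_nonneg x)))
        linarith [Real.exp_pos (θ 0 * -x + θ 1 * (-x) ^ 2)]
      · have h' : 0 ≤ θ 0 * -x := by linarith
        have := Real.one_le_exp (add_nonneg h' (mul_nonneg h1 (sq_nonneg (-x))))
        linarith [Real.exp_pos (θ 0 * x + θ 1 * x ^ 2)]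
    simp [integrable_const_iff, isFiniteMeasure_iff] at h2
  hasGradientAt _ hθ := hasGradientAt_gaussLogPartition hθ
  injOn := by
    intro θ hθ θ' hθ' h
    obtain ⟨m, v, hv, rfl⟩ := exists_eq_gaussNatural hθ
    obtain ⟨m', v', hv', rfl⟩ := exists_eq_gaussNatural hθ'
    rw [gaussMoments_gaussNatural hv, gaussMoments_gaussNatural hv'] at h
    have h0 := congrArg (fun z : EuclideanSpace ℝ (Fin 2) => z 0) h
    have h1 := congrArg (fun z : EuclideanSpace ℝ (Fin 2) => z 1) h
    simp at h0 h1
    subst h0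
    rw [add_left_cancel h1]

lemma setIntegral_gaussParams (h : ℝ × ℝ → ℝ) :
    ∫ θ in gaussParams, h (θ 0, θ 1)
      = ∫ z, h z ∂((volume : Measure ℝ).prod (volume.restrict (Set.Iio (0 : ℝ)))) := by
  have hmp : MeasurePreserving (fun θ : EuclideanSpace ℝ (Fin 2) => ((θ 0, θ 1) : ℝ × ℝ)) :=
    (volume_preserving_finTwoArrow ℝ).comp (PiLp.volume_preserving_ofLp (Fin 2))
  have hemb : MeasurableEmbedding (fun θ : EuclideanSpace ℝ (Fin 2) => ((θ 0, θ 1) : ℝ × ℝ)) :=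
    (MeasurableEquiv.finTwoArrow.measurableEmbedding).comp
      (MeasurableEquiv.toLp 2 (Fin 2 → ℝ)).symm.measurableEmbedding
  have hpre : gaussParams = (fun θ : EuclideanSpace ℝ (Fin 2) => ((θ 0, θ 1) : ℝ × ℝ)) ⁻¹'
      (Set.univ ×ˢ Set.Iio 0) := by
    ext θ
    simp [gaussParams]
  rw [hpre, hmp.setIntegral_preimage_emb hemb, Measure.volume_eq_prod, ← Measure.prod_restrict,
    Measure.restrict_univ]

/-- Integrating out the first natural parameter is a Gaussian integral, which leaves a Gamma
integral in the second one. -/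
lemma integral_prod_exp_gauss {a v : ℝ} (ha : 0 < a) (hv : 0 < v) (m : ℝ) :
    ∫ z : ℝ × ℝ, Real.exp (-a * (-(1 / 4) * (z.1 ^ 2 * z.2⁻¹) - 1 / 2 * Real.log (-z.2)
        - (z.1 * m + z.2 * (m ^ 2 + v))))
      ∂((volume : Measure ℝ).prod (volume.restrict (Set.Iio (0 : ℝ))))
      = √(4 * Real.pi / a) * ((1 / (a * v)) ^ ((a + 3) / 2) * Real.Gamma ((a + 3) / 2)) := by
  have hin : ∀ y ∈ Set.Iio (0 : ℝ), ∫ x : ℝ, Real.exp (-a * (-(1 / 4) * (x ^ 2 * y⁻¹)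
        - 1 / 2 * Real.log (-y) - (x * m + y * (m ^ 2 + v))))
      = (fun s => √(4 * Real.pi / a) * (s ^ ((a + 3) / 2 - 1) * Real.exp (-(a * v * s))))
          (0 - y) := by
    intro y hy
    have hs : 0 < -y := neg_pos.2 hy
    have hy0 : y ≠ 0 := (show y < 0 from hy).ne
    have e : ∀ x : ℝ, Real.exp (-a * (-(1 / 4) * (x ^ 2 * y⁻¹)
        - 1 / 2 * Real.log (-y) - (x * m + y * (m ^ 2 + v))))
        = Real.exp (a / 2 * Real.log (-y) + a * y * (m ^ 2 + v))
          * Real.exp (-(a / (4 * -y)) * x ^ 2 + a * m * x) := by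
      intro x
      rw [← Real.exp_add]
      congr 1
      field_simp
      ring
    have e2 : √(Real.pi / (a / (4 * -y))) = √(4 * Real.pi / a) * √(-y) := by
      rw [← Real.sqrt_mul (by positivity)]
      congr 1
      field_simp
    simp only [e]
    rw [integral_const_mul, integral_exp_neg_mul_sq_add_mul (by positivity), e2,
      Real.sqrt_eq_rpow (-y), Real.rpow_def_of_pos hs, zero_sub, Real.rpow_def_of_pos hs,
      ← Real.exp_add, mul_left_comm (Real.exp ((a * m) ^ 2 / _)), mul_left_comm, ← Real.exp_add,
      ← Real.exp_add]
    congr 2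
    field_simp
    ring
  have hval : ∫ y in Set.Iio (0 : ℝ), ∫ x : ℝ, Real.exp (-a * (-(1 / 4) * (x ^ 2 * y⁻¹)
        - 1 / 2 * Real.log (-y) - (x * m + y * (m ^ 2 + v))))
      = √(4 * Real.pi / a) * ((1 / (a * v)) ^ ((a + 3) / 2) * Real.Gamma ((a + 3) / 2)) := by
    rw [setIntegral_congr_fun measurableSet_Iio hin, setIntegral_Iio_comp_sub_left
      (fun s => √(4 * Real.pi / a) * (s ^ ((a + 3) / 2 - 1) * Real.exp (-(a * v * s)))),
      integral_const_mul, Real.integral_rpow_mul_exp_neg_mul_Ioi (by positivity) (by positivity)]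
  have hΓ : 0 < Real.Gamma ((a + 3) / 2) := Real.Gamma_pos_of_pos (by positivity)
  have hint : Integrable (fun z : ℝ × ℝ => Real.exp (-a * (-(1 / 4) * (z.1 ^ 2 * z.2⁻¹)
      - 1 / 2 * Real.log (-z.2) - (z.1 * m + z.2 * (m ^ 2 + v)))))
      ((volume : Measure ℝ).prod (volume.restrict (Set.Iio (0 : ℝ)))) := by
    rw [integrable_prod_iff' (Measurable.aestronglyMeasurable (by fun_prop))]
    constructor
    · filter_upwards [ae_restrict_mem measurableSet_Iio] with y hy
      refine Integrable.of_integral_ne_zero ?_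
      have hs : 0 < 0 - y := by simpa using hy
      rw [hin y hy]
      positivity
    · simp only [Real.norm_of_nonneg (Real.exp_nonneg _)]
      refine Integrable.of_integral_ne_zero ?_
      rw [hval]
      positivity
  rw [integral_prod_symm _ hint, hval]

lemma Q_eq (n : ℕ) (x : ℕ → ℝ) (μ : ℝ) :
    Q μ n x = ∑ t ∈ Finset.range n, x t ^ 2 - 2 * μ * S n x + n * μ ^ 2 := by
  simp only [Q, S, sub_sq, Finset.sum_add_distrib, Finset.sum_sub_distrib, Finset.mul_sum,
    Finset.sum_const, Finset.card_range, nsmul_eq_mul]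
  congr 2
  exact Finset.sum_congr rfl fun t _ => by ring

lemma mul_Q_sampleMean (n : ℕ) (x : ℕ → ℝ) :
    n * Q (S n x / n) n x = n * ∑ t ∈ Finset.range n, x t ^ 2 - S n x ^ 2 := by
  rcases eq_or_ne n 0 with rfl | hn
  · simp [S]
  · have hn' : (n : ℝ) ≠ 0 := Nat.cast_ne_zero.2 hn
    rw [Q_eq]
    field_simp
    ring

lemma W_pos {c μ σ : ℝ} (hc : 0 < c) (n : ℕ) (x : ℕ → ℝ) : 0 < W c μ σ n x := by
  have hQ : ∀ m, 0 ≤ Q m n x := fun m => Finset.sum_nonneg fun _ _ => sq_nonneg _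
  have h1 := hQ (S n x / n)
  have h2 := hQ μ
  unfold W Z
  positivity

/-- `W` is the ratio of `n + c` times the variance at the estimate to the true variance. -/
lemma sq_mul_W {c μ σ : ℝ} (hc : 0 < c) (hσ : 0 < σ) (n : ℕ) (x : ℕ → ℝ) :
    σ ^ 2 * W c μ σ n x = ∑ t ∈ Finset.range n, x t ^ 2 + c * (μ ^ 2 + σ ^ 2)
      - (S n x + c * μ) ^ 2 / (n + c) := by
  have hn : 0 < (n : ℝ) + c := by positivity
  have h1 := mul_Q_sampleMean n x
  have h2 := Q_eq n x μ
  have e : σ ^ 2 * W c μ σ n x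
      = (n * Q (S n x / n) n x + c * Q μ n x) / (n + c) + c * σ ^ 2 := by
    rw [W, Z, Z]
    field_simp
  rw [e, h1, h2]
  field_simp
  ring

theorem explicitSet_gaussian {Ω : Type*} [MeasurableSpace Ω] (P : Measure Ω)
    [IsProbabilityMeasure P] {c δ : ℝ} (hc : 0 < c) (hδ : 0 < δ) (μ σ : ℝ) (hσ : 0 < σ) :
    ExplicitSet P
      (ENNReal.ofReal (1 / √Real.pi) • (volume : Measure ℝ)) (fun x : ℝ => !₂[x, x ^ 2])
      gaussParams (volume.restrict gaussParams) c δ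
      (gaussianReal μ (Real.toNNReal (σ ^ 2))) !₂[μ / σ ^ 2, -1 / (2 * σ ^ 2)] Set.univ
      (fun n x => 3 / 2 * Real.log (W c μ σ n x)
        + (n + c + 1) / 2 * Real.log (n + c) - (c / 2 + 2) * Real.log c
        - n / 2 * (1 + Real.log 2)
        + Real.log (Real.Gamma ((c + 3) / 2)) - Real.log (Real.Gamma ((n + c + 3) / 2)))
      (fun n x => 1 / 2 * Z μ σ n x
          - (n + c + 3) / 2 * Real.log (W c μ σ n x) ≤
        Real.log (1 / δ) - n / 2 * Real.log 2 - (c / 2 + 2) * Real.log c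
          + 1 / 2 * Real.log (n + c)
          + Real.log (Real.Gamma ((c + 3) / 2)) - Real.log (Real.Gamma ((n + c + 3) / 2))) := by
  have hσ2 : 0 < σ ^ 2 := by positivity
  have hnc : ∀ n : ℕ, 0 < (n : ℝ) + c := fun n => by positivity
  have hθ : (!₂[μ / σ ^ 2, -1 / (2 * σ ^ 2)] : EuclideanSpace ℝ (Fin 2))
    = gaussNatural μ (σ ^ 2) := rfl
  have hvar : ∀ v : ℝ, 0 < v → ∀ m, -(1 / (2 * gaussNatural m v 1)) = v := by
    intro v hv m
    change -(1 / (2 * (-1 / (2 * v)))) = v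
    field_simp
  rw [hθ]
  have hF : Measurable fun x : ℝ => (!₂[x, x ^ 2] : EuclideanSpace ℝ (Fin 2)) := by
    refine (MeasurableEquiv.toLp 2 (Fin 2 → ℝ)).measurable.comp ?_
    refine measurable_pi_lambda _ fun i => ?_
    fin_cases i
    · exact measurable_id
    · exact measurable_id.pow_const 2
  have hmeas : MeasurableSet gaussParams := isExplicitFamily_gauss.isOpen.measurableSet
  have hvn : ∀ (n : ℕ) (x : ℕ → ℝ), 0 < σ ^ 2 * W c μ σ n x / (n + c) := fun n x => by
    have := W_pos (μ := μ) (σ := σ) hc n x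
    have := hnc n
    positivity
  refine ExplicitSet.of_isExplicitFamily isExplicitFamily_gauss hF subset_rfl
    (ae_restrict_mem hmeas) hc hδ (gaussNatural_mem hσ2) ?_ (by simp)
    (fun n x => gaussNatural ((S n x + c * μ) / (n + c)) (σ ^ 2 * W c μ σ n x / (n + c)))
    (fun a θ => Real.exp (a * (1 / 2 * Real.log (2 * -(1 / (2 * θ 1))) + 1 / 2))
      * (√(4 * Real.pi / a) * ((1 / (a * -(1 / (2 * θ 1)))) ^ ((a + 3) / 2)
        * Real.Gamma ((a + 3) / 2)))) ?_ ?_ ?_ ?_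
  · have hv : Real.toNNReal (σ ^ 2) ≠ 0 := by simpa using hσ.ne'
    have hcoe : ((Real.toNNReal (σ ^ 2) : NNReal) : ℝ) = σ ^ 2 := Real.coe_toNNReal _ hσ2.le
    rw [gaussianReal_of_var_ne_zero μ hv, withDensity_smul_measure,
      ← withDensity_smul' _ _ ENNReal.ofReal_ne_top]
    congr 1
    funext x
    simp only [gaussianPDF, gaussianPDFReal, Pi.smul_apply, smul_eq_mul, hcoe]
    rw [← ENNReal.ofReal_mul (by positivity), gaussLogPartition_gaussNatural hσ2,
      inner_euclideanSpace_two]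
    congr 1
    have e1 : Real.exp (-(1 / 2 * Real.log (2 * σ ^ 2))) = (√(2 * σ ^ 2))⁻¹ := by
      rw [Real.sqrt_eq_rpow, Real.rpow_def_of_pos (by positivity), ← Real.exp_neg]
      ring_nf
    have e2 : gaussNatural μ (σ ^ 2) 0 * x + gaussNatural μ (σ ^ 2) 1 * x ^ 2
        - (μ ^ 2 / (2 * σ ^ 2) + 1 / 2 * Real.log (2 * σ ^ 2))
        = -(x - μ) ^ 2 / (2 * σ ^ 2) + -(1 / 2 * Real.log (2 * σ ^ 2)) := by
      change μ / σ ^ 2 * x + -1 / (2 * σ ^ 2) * x ^ 2 - _ = _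
      field_simp
      ring
    have e3 : 2 * Real.pi * σ ^ 2 = Real.pi * (2 * σ ^ 2) := by ring
    rw [e2, Real.exp_add, e1, e3, Real.sqrt_mul Real.pi_nonneg]
    ring
  · intro n x _
    have hn := hnc n
    refine ⟨gaussNatural_mem (hvn n x), ?_⟩
    rw [gaussMoments_gaussNatural (hvn n x), gaussMoments_gaussNatural hσ2, sq_mul_W hc hσ]
    ext i
    fin_cases i
    · simp [S]
      field_simp
    · simp
      field_simp
      ring
  · intro a ha θ hθ
    obtain ⟨m, v, hv, rfl⟩ := exists_eq_gaussNatural hθ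
    rw [hvar v hv]
    have hΓ : 0 < Real.Gamma ((a + 3) / 2) := Real.Gamma_pos_of_pos (by positivity)
    refine ⟨by positivity, ?_⟩
    rw [← integral_prod_exp_gauss ha hv m, ← integral_const_mul, ← setIntegral_gaussParams
      (fun z => Real.exp (a * (1 / 2 * Real.log (2 * v) + 1 / 2)) *
        Real.exp (-a * (-(1 / 4) * (z.1 ^ 2 * z.2⁻¹) - 1 / 2 * Real.log (-z.2)
        - (z.1 * m + z.2 * (m ^ 2 + v)))))]
    congr 1
    funext θ'
    rw [← Real.exp_add, gaussMoments_gaussNatural hv, gaussLogPartition_gaussNatural hv,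
      inner_sub_left, inner_euclideanSpace_two, inner_euclideanSpace_two, gaussLogPartition]
    have e : gaussNatural m v 0 * m + gaussNatural m v 1 * (m ^ 2 + v)
        = m ^ 2 / (2 * v) - 1 / 2 := by
      change m / v * m + -1 / (2 * v) * (m ^ 2 + v) = _
      field_simp
      ring
    rw [e]
    congr 1
    ring
  · intro n x _
    have hn := hnc n
    have hW := W_pos (μ := μ) (σ := σ) hc n x
    have hlog : ∀ a v : ℝ, 0 < a → 0 < v →
        0 < Real.exp (a * (1 / 2 * Real.log (2 * v) + 1 / 2))
          * (√(4 * Real.pi / a) * ((1 / (a * v)) ^ ((a + 3) / 2) * Real.Gamma ((a + 3) / 2))) ∧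
        Real.log (Real.exp (a * (1 / 2 * Real.log (2 * v) + 1 / 2))
          * (√(4 * Real.pi / a) * ((1 / (a * v)) ^ ((a + 3) / 2) * Real.Gamma ((a + 3) / 2))))
        = a * (1 / 2 * (Real.log 2 + Real.log v) + 1 / 2)
          + ((Real.log (4 * Real.pi) - Real.log a) / 2
            + (-((a + 3) / 2 * (Real.log a + Real.log v))
              + Real.log (Real.Gamma ((a + 3) / 2)))) := by
      intro a v ha hv
      have hΓ : 0 < Real.Gamma ((a + 3) / 2) := Real.Gamma_pos_of_pos (by positivity)
      refine ⟨by positivity, ?_⟩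
      rw [Real.log_mul (by positivity) (by positivity), Real.log_exp,
        Real.log_mul two_ne_zero hv.ne', Real.log_mul (by positivity) (by positivity),
        Real.log_mul (by positivity) hΓ.ne', Real.log_sqrt (by positivity),
        Real.log_rpow (by positivity), one_div (a * v), Real.log_inv, Real.log_mul ha.ne' hv.ne',
        Real.log_div (by positivity) ha.ne']
      ring
    rw [hvar _ hσ2, hvar _ (hvn n x)]
    obtain ⟨h1, h2⟩ := hlog c (σ ^ 2) hc hσ2
    obtain ⟨h3, h4⟩ := hlog (n + c) _ hn (hvn n x)
    rw [Real.log_div h1.ne' h3.ne', h2, h4, Real.log_div (by positivity) hn.ne',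
      Real.log_mul hσ2.ne' hW.ne']
    ring
  · intro n x _
    have hn := hnc n
    have hW := W_pos (μ := μ) (σ := σ) hc n x
    have hv := hvn n x
    have e : ((n : ℝ) + c) * (gaussLogPartition (gaussNatural μ (σ ^ 2))
        - gaussLogPartition (gaussNatural ((S n x + c * μ) / (n + c))
          (σ ^ 2 * W c μ σ n x / (n + c)))
        - inner ℝ (gaussNatural μ (σ ^ 2) - gaussNatural ((S n x + c * μ) / (n + c))
          (σ ^ 2 * W c μ σ n x / (n + c))) (gaussMoments (gaussNatural
            ((S n x + c * μ) / (n + c)) (σ ^ 2 * W c μ σ n x / (n + c)))))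
        = 1 / 2 * Z μ σ n x - n / 2
          - (n + c) / 2 * (Real.log (W c μ σ n x) - Real.log (n + c)) := by
      -- the divergence is the relative entropy of two Gaussian distributions
      have hdiv : ∀ m v : ℝ, 0 < v → gaussLogPartition (gaussNatural μ (σ ^ 2))
          - gaussLogPartition (gaussNatural m v)
          - inner ℝ (gaussNatural μ (σ ^ 2) - gaussNatural m v) (gaussMoments (gaussNatural m v))
          = 1 / 2 * (Real.log (σ ^ 2) - Real.log v) + ((μ - m) ^ 2 + v) / (2 * σ ^ 2)
            - 1 / 2 := by
        intro m v hv
        rw [gaussMoments_gaussNatural hv, gaussLogPartition_gaussNatural hv,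
          gaussLogPartition_gaussNatural hσ2, inner_euclideanSpace_two,
          Real.log_mul two_ne_zero hv.ne', Real.log_mul two_ne_zero hσ2.ne']
        change _ - _ - ((μ / σ ^ 2 - m / v) * m
          + (-1 / (2 * σ ^ 2) - -1 / (2 * v)) * (m ^ 2 + v)) = _
        field_simp
        ring
      have hZ : ((n : ℝ) + c) * (((μ - (S n x + c * μ) / (n + c)) ^ 2
          + σ ^ 2 * W c μ σ n x / (n + c)) / (2 * σ ^ 2)) = 1 / 2 * Z μ σ n x + c / 2 := by
        rw [sq_mul_W hc hσ, Z, Q_eq]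
        field_simp
        ring
      rw [hdiv _ _ hv, Real.log_div (by positivity) hn.ne', Real.log_mul hσ2.ne' hW.ne', mul_sub,
        mul_add, hZ]
      ring
    rw [e]
    constructor <;> intro h <;> linarith

end Gaussian2

end BregmanCS

theorem mainTheorem5 {Ω : Type*} [MeasurableSpace Ω] (P : Measure Ω) [IsProbabilityMeasure P]
    (c δ : ℝ) (hc : 0 < c) (hδ : 0 < δ) (hδ' : δ ≤ 1) :
    -- Gaussian, unknown mean `μ`, known standard deviation `σ`
    (∀ μ σ : ℝ, 0 < σ →
      BregmanCS.ExplicitSet P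
        (gaussianReal 0 (Real.toNNReal (σ ^ 2))) (fun x : ℝ => x / σ ^ 2)
        (Set.univ : Set ℝ) volume c δ
        (gaussianReal μ (Real.toNNReal (σ ^ 2))) μ Set.univ
        (fun n _ => 1 / 2 * Real.log ((n + c) / c))
        (fun n x => 1 / (n + c) * ((BregmanCS.S n x - n * μ) ^ 2 / (2 * σ ^ 2)) ≤
          Real.log (1 / δ) + 1 / 2 * Real.log ((n + c) / c))) ∧
    -- Gaussian, known mean `μ`, unknown standard deviation `σ`
    (∀ μ σ : ℝ, 0 < σ →
      BregmanCS.ExplicitSet P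
        (ENNReal.ofReal (1 / √(2 * Real.pi)) • (volume : Measure ℝ)) (fun x : ℝ => (x - μ) ^ 2)
        (Set.Iio (0 : ℝ)) (volume.restrict (Set.Iio 0)) c δ
        (gaussianReal μ (Real.toNNReal (σ ^ 2))) (-1 / (2 * σ ^ 2)) Set.univ
        (fun n x => Real.log ((BregmanCS.Q μ n x / σ ^ 2 + c) / (n + c))
          - (1 + Real.log 2) * (n / 2) - (c / 2 + 1) * Real.log c
          + ((n + c) / 2 + 1) * Real.log (n + c)
          + Real.log (Real.Gamma (c / 2 + 1) / Real.Gamma ((n + c) / 2 + 1)))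
        (fun n x => BregmanCS.Q μ n x / (2 * σ ^ 2)
            - ((n + c) / 2 + 1) * Real.log (BregmanCS.Q μ n x / σ ^ 2 + c) ≤
          Real.log (1 / δ) + Real.log (Real.Gamma (c / 2 + 1) / Real.Gamma ((n + c) / 2 + 1))
            - n / 2 * Real.log 2 - (c / 2 + 1) * Real.log c)) ∧
    -- Gaussian, unknown mean `μ` and standard deviation `σ`
    (∀ μ σ : ℝ, 0 < σ →
      BregmanCS.ExplicitSet P
        (ENNReal.ofReal (1 / √Real.pi) • (volume : Measure ℝ)) (fun x : ℝ => !₂[x, x ^ 2])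
        BregmanCS.gaussParams (volume.restrict BregmanCS.gaussParams) c δ
        (gaussianReal μ (Real.toNNReal (σ ^ 2))) !₂[μ / σ ^ 2, -1 / (2 * σ ^ 2)] Set.univ
        (fun n x => 3 / 2 * Real.log (BregmanCS.W c μ σ n x)
          + (n + c + 1) / 2 * Real.log (n + c) - (c / 2 + 2) * Real.log c
          - n / 2 * (1 + Real.log 2)
          + Real.log (Real.Gamma ((c + 3) / 2)) - Real.log (Real.Gamma ((n + c + 3) / 2)))
        (fun n x => 1 / 2 * BregmanCS.Z μ σ n x
            - (n + c + 3) / 2 * Real.log (BregmanCS.W c μ σ n x) ≤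
          Real.log (1 / δ) - n / 2 * Real.log 2 - (c / 2 + 2) * Real.log c
            + 1 / 2 * Real.log (n + c)
            + Real.log (Real.Gamma ((c + 3) / 2)) - Real.log (Real.Gamma ((n + c + 3) / 2)))) ∧
    -- Bernoulli, unknown mean `μ`
    (∀ (μ : unitInterval), 0 < (μ : ℝ) → (μ : ℝ) < 1 →
      BregmanCS.ExplicitSet P
        (Measure.dirac 0 + Measure.dirac 1 : Measure ℝ) (fun x : ℝ => x)
        (Set.univ : Set ℝ) volume c δ
        (bernoulliMeasure (1 : ℝ) 0 μ) (Real.log (μ / (1 - μ))) {0, 1}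
        (fun n x => c * Real.binEntropy μ
          - (n + c) * Real.binEntropy ((BregmanCS.S n x + c * μ) / (n + c))
          + Real.log (beta (c * μ) (c * (1 - μ)) /
              beta (BregmanCS.S n x + c * μ) (n - BregmanCS.S n x + c * (1 - μ))))
        (fun n x => BregmanCS.S n x * Real.log (1 / μ)
            + (n - BregmanCS.S n x) * Real.log (1 / (1 - μ))
            + Real.log (Real.Gamma (BregmanCS.S n x + c * μ)
                * Real.Gamma (n - BregmanCS.S n x + c * (1 - μ))
                / (Real.Gamma (c * μ) * Real.Gamma (c * (1 - μ)))) ≤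
          Real.log (1 / δ) + Real.log (Real.Gamma (n + c) / Real.Gamma c))) ∧
    -- Exponential, unknown mean `μ`
    (∀ μ : ℝ, 0 < μ →
      BregmanCS.ExplicitSet P
        (volume.restrict (Set.Ici (0 : ℝ))) (fun x : ℝ => x)
        (Set.Iio (0 : ℝ)) (volume.restrict (Set.Iio 0)) c δ
        (expMeasure (1 / μ)) (-1 / μ) (Set.Ici 0)
        (fun n x => Real.log (BregmanCS.S n x / μ + c)
          + Real.log (Real.Gamma c / Real.Gamma (n + c))
          + (n + c - 1) * Real.log (n + c) - c * Real.log c - n)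
        (fun n x => BregmanCS.S n x / μ
            - (n + c + 1) * Real.log (BregmanCS.S n x / μ + c) ≤
          Real.log (1 / δ) + Real.log (Real.Gamma c / Real.Gamma (n + c))
            - Real.log (n + c) - c * Real.log c)) ∧
    -- Gamma, fixed shape `k`, unknown scale `l`
    (∀ k l : ℝ, 0 < k → 0 < l →
      BregmanCS.ExplicitSet P
        ((volume.restrict (Set.Ici (0 : ℝ))).withDensity
          fun x => ENNReal.ofReal (x ^ (k - 1) / Real.Gamma k)) (fun x : ℝ => x)
        (Set.Iio (0 : ℝ)) (volume.restrict (Set.Iio 0)) c δ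
        (gammaMeasure k (1 / l)) (-1 / l) (Set.Ici 0)
        (fun n x => Real.log ((BregmanCS.S n x + c * k * l) / ((n + c) * k * l))
          + Real.log (Real.Gamma (c * k) * (Real.exp 1 / (c * k)) ^ (c * k))
          - Real.log (Real.Gamma ((n + c) * k)
              * (Real.exp 1 / ((n + c) * k)) ^ ((n + c) * k)))
        (fun n x => BregmanCS.S n x / l
            - ((n + c) * k + 1) * Real.log (BregmanCS.S n x / l + c * k) ≤
          Real.log (1 / δ) + Real.log (Real.Gamma (c * k) / Real.Gamma ((n + c) * k))
            - Real.log ((n + c) * k) - c * k * Real.log (c * k))) ∧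
    -- Weibull, fixed shape `k`, unknown scale `l`
    (∀ k l : ℝ, 0 < k → 0 < l →
      BregmanCS.ExplicitSet P
        ((volume.restrict (Set.Ici (0 : ℝ))).withDensity
          fun x => ENNReal.ofReal (k * x ^ (k - 1))) (fun x : ℝ => x ^ k)
        (Set.Iio (0 : ℝ)) (volume.restrict (Set.Iio 0)) c δ
        (BregmanCS.weibullMeasure l k) (-1 / l ^ k) (Set.Ici 0)
        (fun n x => Real.log ((BregmanCS.Spow k n x + c * l ^ k) / ((n + c) * l ^ k))
          + Real.log (Real.Gamma c * (Real.exp 1 / c) ^ c)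
          - Real.log (Real.Gamma (n + c) * (Real.exp 1 / (n + c)) ^ (n + c)))
        (fun n x => BregmanCS.Spow k n x / l ^ k
            - (n + c + 1) * Real.log (BregmanCS.Spow k n x / l ^ k + c) ≤
          Real.log (1 / δ) + Real.log (Real.Gamma c / Real.Gamma (n + c))
            - Real.log (n + c) - c * Real.log c)) ∧
    -- Pareto with scale `1`, unknown shape `α`
    (∀ α : ℝ, 0 < α →
      BregmanCS.ExplicitSet P
        (volume.restrict (Set.Ici (1 : ℝ))) (fun x : ℝ => Real.log x)
        (Set.Iio (-1 : ℝ)) (volume.restrict (Set.Iio (-1))) c δ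
        (paretoMeasure 1 α) (-1 - α) (Set.Ici 1)
        (fun n x => Real.log (α * BregmanCS.Llog n x + c)
          + Real.log (Real.Gamma c / Real.Gamma (n + c))
          + (n + c - 1) * Real.log (n + c) - c * Real.log c - n)
        (fun n x => α * BregmanCS.Llog n x
            - (n + c + 1) * Real.log (α * BregmanCS.Llog n x + c) ≤
          Real.log (1 / δ) + Real.log (Real.Gamma c / Real.Gamma (n + c))
            - Real.log (n + c) - c * Real.log c)) ∧
    -- Poisson, unknown mean `l`
    (∀ l : ℝ, 0 < l →
      BregmanCS.ExplicitSet P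
        (Measure.count.withDensity fun k : ℕ => ENNReal.ofReal (1 / (Nat.factorial k : ℝ)))
        (fun k : ℕ => (k : ℝ))
        (Set.univ : Set ℝ) volume c δ
        (poissonMeasure (Real.toNNReal l)) (Real.log l) Set.univ
        (fun n x => c * (1 - Real.log l) * l
          - (1 - Real.log ((BregmanCS.S n (fun t => (x t : ℝ)) + c * l) / (n + c)))
              * (BregmanCS.S n (fun t => (x t : ℝ)) + c * l)
          + Real.log (BregmanCS.I c (c * l))
          - Real.log (BregmanCS.I (n + c) (BregmanCS.S n (fun t => (x t : ℝ)) + c * l)))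
        (fun n x => n * l - BregmanCS.S n (fun t => (x t : ℝ)) * Real.log l ≤
          Real.log (1 / δ) + Real.log (BregmanCS.I c (c * l))
            - Real.log (BregmanCS.I (n + c) (BregmanCS.S n (fun t => (x t : ℝ)) + c * l)))) ∧
    -- Chi-square, unknown real `k > 0`, mixture over Lebesgue measure
    (∀ k : ℝ, 0 < k →
      BregmanCS.ExplicitSet P
        ((volume.restrict (Set.Ioi (0 : ℝ))).withDensity
          fun x => ENNReal.ofReal (Real.exp (-x / 2))) (fun x : ℝ => Real.log x)
        (Set.Ioi (-1 : ℝ)) (volume.restrict (Set.Ioi (-1))) c δ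
        (BregmanCS.chiSqMeasure k) ((k : ℝ) / 2 - 1) (Set.Ioi 0)
        (fun n x => BregmanCS.chiSqEstimate c n x k / 2
            * (BregmanCS.K n x + c * BregmanCS.digamma ((k : ℝ) / 2))
          - (n + c) * Real.log (Real.Gamma (BregmanCS.chiSqEstimate c n x k / 2))
          + c * Real.log (Real.Gamma ((k : ℝ) / 2))
          - c * ((k : ℝ) / 2) * BregmanCS.digamma ((k : ℝ) / 2)
          + Real.log (BregmanCS.J c (c * BregmanCS.digamma ((k : ℝ) / 2)) /
              BregmanCS.J (n + c)
                (BregmanCS.K n x + c * BregmanCS.digamma ((k : ℝ) / 2))))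
        (fun n x => n * Real.log (Real.Gamma ((k : ℝ) / 2)) - (k : ℝ) / 2 * BregmanCS.K n x
            - Real.log (BregmanCS.J c (c * BregmanCS.digamma ((k : ℝ) / 2)))
            + Real.log (BregmanCS.J (n + c)
                (BregmanCS.K n x + c * BregmanCS.digamma ((k : ℝ) / 2))) ≤
          Real.log (1 / δ))) ∧
    -- Chi-square, unknown integer `k ≥ 1`, mixture over counting measure
    (∀ k : ℕ, 1 ≤ k →
      BregmanCS.ExplicitSet P
        ((volume.restrict (Set.Ioi (0 : ℝ))).withDensity
          fun x => ENNReal.ofReal (Real.exp (-x / 2))) (fun x : ℝ => Real.log x)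
        BregmanCS.chiSqParams (Measure.count.restrict BregmanCS.chiSqParams) c δ
        (BregmanCS.chiSqMeasure k) ((k : ℝ) / 2 - 1) (Set.Ioi 0)
        (fun n x => BregmanCS.chiSqEstimate c n x k / 2
            * (BregmanCS.K n x + c * BregmanCS.digamma ((k : ℝ) / 2))
          - (n + c) * Real.log (Real.Gamma (BregmanCS.chiSqEstimate c n x k / 2))
          + c * Real.log (Real.Gamma ((k : ℝ) / 2))
          - c * ((k : ℝ) / 2) * BregmanCS.digamma ((k : ℝ) / 2)
          + Real.log (BregmanCS.JNat c (c * BregmanCS.digamma ((k : ℝ) / 2)) /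
              BregmanCS.JNat (n + c)
                (BregmanCS.K n x + c * BregmanCS.digamma ((k : ℝ) / 2))))
        (fun n x => n * Real.log (Real.Gamma ((k : ℝ) / 2)) - (k : ℝ) / 2 * BregmanCS.K n x
            - Real.log (BregmanCS.JNat c (c * BregmanCS.digamma ((k : ℝ) / 2)))
            + Real.log (BregmanCS.JNat (n + c)
                (BregmanCS.K n x + c * BregmanCS.digamma ((k : ℝ) / 2))) ≤
          Real.log (1 / δ))) := by
  exact ⟨BregmanCS.explicitSet_gaussian_mean P hc hδ,
    BregmanCS.explicitSet_gaussian_variance P hc hδ,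
    BregmanCS.explicitSet_gaussian P hc hδ, BregmanCS.explicitSet_bernoulli P hc hδ,
    BregmanCS.explicitSet_exponential P hc hδ, BregmanCS.explicitSet_gamma P hc hδ,
    BregmanCS.explicitSet_weibull P hc hδ, BregmanCS.explicitSet_pareto P hc hδ,
    BregmanCS.explicitSet_poisson P hc hδ, BregmanCS.explicitSet_chiSq_real P hc hδ,
    BregmanCS.explicitSet_chiSq_nat P hc hδ⟩
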